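/- Let $F$ be a field of characteristic zero and let $q\in F$ be nonzero and not a root of unity (for instance, $F=\mathbb Q(q)$ with $q$ an indeterminate). Put $t=q$. Let $\mathrm{Sym}$ be the algebra of symmetric functions over $F$, $\widehat{\mathrm{Sym}}$ its completion (symmetric formal power series of unbounded degree), and let $\langle\cdot,\cdot\rangle_{q,t}$ be the Macdonald scalar product, $\langle p_\lambda,p_\mu\rangle_{q,t}=\delta_{\lambda\mu}z_\lambda\prod_i\frac{1-q^{\lambda_i}}{1-t^{\lambda_i}}$, extended to a pairing of $\mathrm{Sym}$ with $\widehat{\mathrm{Sym}}$. Let $P_\mu$ be the Macdonald symmetric functions with parameters $(q,t)$ and $P_{\mu|N}$ the corresponding polynomials in $N$ variables. For $\ell(\mu)\le N$ let $I_{\mu|N}(x_1,\dots,x_N;q,t)$ be the interpolation polynomial: the symmetric polynomial of degree $|\mu|$ with $I_{\mu|N}=P_{\mu|N}+{}$lower degree terms, which does not vanish at $X_N(\mu)$ and vanishes at $X_N(\lambda)$ for all $\lambda\neq\mu$ with $\ell(\lambda)\le N$, $|\lambda|\le|\mu|$, where $X_N(\lambda)=(q^{-\lambda_1},q^{-\lambda_2}t,\dots,q^{-\lambda_N}t^{N-1})$.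 Let $I_\mu(\cdot;q,t)\in\mathrm{Sym}$ be the function such that $\varphi_N(I_\mu)=I_{\mu|N}$ for all $N\ge1$ with $N\ge\ell(\mu)$, where $\varphi_N:\mathrm{Sym}\to\mathrm{Sym}(N)$ is the algebra morphism with $\varphi_N(p_n)=x_1^n+\dots+x_N^n+\frac{t^{Nn}}{1-t^n}$. Let $H_\mu(\cdot;q,t)\in\widehat{\mathrm{Sym}}$ be the dual family, $\langle I_\mu,H_\nu\rangle_{q,t}=\delta_{\mu\nu}$, and set $$\tilde H_{\mu|N}(u_1,\dots,u_N;q,t)=H_\mu(u_1^{-1},\dots,u_N^{-1},0,0,\dots;q,t)\prod_{j=1}^N(u_j^{-1};q)_\infty\in F[[u_1^{-1},\dots,u_N^{-1}]],$$ where $(z;q)_\infty=\prod_{n\ge0}(1-zq^n)$ is understood as the power series $\exp\bigl(-\sum_{m\ge1}\frac{z^m}{m(1-q^m)}\bigr)$. Then for every $N\ge1$ and every partition $\mu$, $$\tilde H_{\mu|N}(u_1,\dots,u_N;q,q)=\sigma_{\mu|N}(u_1,\dots,u_N\mid q^{N-2},q^{N-3},q^{N-4},\dots),$$ where the dual multiparameter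 Schur function is $$\sigma_{\mu|N}(u_1,\dots,u_N\mid c_1,c_2,\dots)=\frac{\det\left[\dfrac1{(u_j-c_1)\cdots(u_j-c_{\mu_i+N-i})}\right]_{i,j=1}^N}{\det\left[\dfrac1{(u_j-c_1)\cdots(u_j-c_{N-i})}\right]_{i,j=1}^N}$$ if $\ell(\mu)\le N$, and $\sigma_{\mu|N}=0$ otherwise; the rational function on the right is expanded as a power series in $u_1^{-1},\dots,u_N^{-1}$. -/

import Mathlib

noncomputable section

namespace InterpMac

/-! ### Partitions

Partitions are identified with Young diagrams: `μ.rowLen i` is the part with (zero-based) index `i`,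
`μ.card` is the size `|μ|`, and `μ.colLen 0` is the number of nonzero parts. -/

/-- The number `ℓ(μ)` of nonzero parts of a partition. -/
def length (μ : YoungDiagram) : ℕ := μ.colLen 0

/-- Dominance order on partitions of the same size: `ν ≤ μ`. -/
def Dominates (μ ν : YoungDiagram) : Prop :=
  ν.card = μ.card ∧
    ∀ k : ℕ, ∑ i ∈ Finset.range k, ν.rowLen i ≤ ∑ i ∈ Finset.range k, μ.rowLen i

/-- The exponent vector `(μ₁, μ₂, …)`. -/
def rowExponent (μ : YoungDiagram) : ℕ →₀ ℕ :=
  Finsupp.onFinset (Finset.range (length μ)) μ.rowLen (by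
    intro i hi
    rw [Finset.mem_range, length, ← YoungDiagram.mem_iff_lt_colLen,
      YoungDiagram.mem_iff_lt_rowLen]
    omega)

/-! ### Symmetric functions -/

section Basics

variable (F : Type*) [Field F]

/-- The algebra of symmetric functions over a field `F` of characteristic zero,
as the polynomial algebra on the power sums; the variable `n : ℕ+` is `p_n`, of degree `n`. -/
abbrev Sym := MvPolynomial ℕ+ F

/-- The completion of `Sym F`: formal series `∑ f_n` with `f_n` symmetric of degree `n`. As there
are only finitely many monomials of given degree in `p_1, p_2, …`, these are exactly
the formal power series in the power sums. -/
abbrev SymHat := MvPowerSeries ℕ+ F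

/-- The power sum `∑_i x_i ^ n` in countably many variables. -/
def powerSumSeries (n : ℕ+) : MvPowerSeries ℕ F :=
  open Classical in fun d => if ∃ i : ℕ, d = Finsupp.single i (n : ℕ) then 1 else 0

/-- The realization of a symmetric function as a formal series in `x_0, x_1, x_2, …`. -/
def toSeries : Sym F →ₐ[F] MvPowerSeries ℕ F := MvPolynomial.aeval (powerSumSeries F)

/-- Specialization to `N` variables, `x_i = 0` for `i > N`. -/
def restrict (N : ℕ) : Sym F →ₐ[F] MvPolynomial (Fin N) F :=
  MvPolynomial.aeval fun n : ℕ+ => MvPolynomial.psum (Fin N) F n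

/-- The power sum `p_n(y_1, …, y_N)` as a formal power series. -/
def psumSeries (N : ℕ) (n : ℕ+) : MvPowerSeries (Fin N) F :=
  (MvPolynomial.psum (Fin N) F n : MvPolynomial (Fin N) F)

/-- The homomorphism from the completed algebra to formal power series in `N` variables,
given by `y_j = 0` for `j > N`. -/
def restrictHat (N : ℕ) (h : SymHat F) : MvPowerSeries (Fin N) F :=
  MvPowerSeries.subst (psumSeries F N) h

/-- The substitution in `restrictHat` is a legitimate one. -/
theorem hasSubst_psumSeries (N : ℕ) : MvPowerSeries.HasSubst (psumSeries F N) where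
  const_coeff n := by
    have : MvPowerSeries.constantCoeff (psumSeries F N n) = 0 := by
      rw [← MvPowerSeries.coeff_zero_eq_constantCoeff_apply, psumSeries, MvPolynomial.coeff_coe,
        ← MvPolynomial.constantCoeff_eq]
      simp [MvPolynomial.psum]
    rw [this]
    exact IsNilpotent.zero
  coeff_zero d := by
    refine ((Set.finite_le_nat d.degree).preimage
      (f := fun n : ℕ+ => (n : ℕ)) (PNat.coe_injective.injOn)).subset ?_
    intro n hn
    rw [Set.mem_ofPred_eq, psumSeries, MvPolynomial.coeff_coe] at hn
    have h : (MvPolynomial.psum (Fin N) F (n : ℕ)).IsHomogeneous n :=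
      MvPolynomial.IsHomogeneous.sum _ _ _ fun i _ => by
        simpa using (MvPolynomial.isHomogeneous_X F i).pow (n : ℕ)
    have h2 := h hn
    have h3 : d.degree = (n : ℕ) := by rw [Finsupp.degree_eq_weight_one]; exact h2
    exact h3.ge

end Basics

section Functions

variable {F : Type*} [Field F]

/-- The squared norm `z_λ ∏ᵢ (1 - q ^ λᵢ) / (1 - t ^ λᵢ)` of `p_λ = ∏ₙ p_n ^ mₙ`,
where `z_λ = ∏ₙ n ^ mₙ mₙ!`. -/
def powerSumNorm (q t : F) (m : ℕ+ →₀ ℕ) : F :=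
  m.prod fun n k =>
    (((n : ℕ) : F) ^ k * (k.factorial : F)) * ((1 - q ^ (n : ℕ)) / (1 - t ^ (n : ℕ))) ^ k

/-- The Macdonald scalar product `⟨f, g⟩_{q,t}`, extended to a pairing of the symmetric functions
with their completion; distinct monomials in the power sums are orthogonal. -/
def pairing (q t : F) (f : Sym F) (g : SymHat F) : F :=
  ∑ m ∈ f.support, f.coeff m * MvPowerSeries.coeff m g * powerSumNorm q t m

/-- Macdonald's characterization of the symmetric functions `P_μ(q,t)`: each `P_μ` is `m_μ` plus
a combination of the monomial symmetric functions `m_ν` with `ν` lower in dominance order,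
and they are pairwise orthogonal. -/
def IsMacdonaldFamily (q t : F) (P : YoungDiagram → Sym F) : Prop :=
  (∀ μ, MvPowerSeries.coeff (rowExponent μ) (toSeries F (P μ)) = 1) ∧
  (∀ μ ν, MvPowerSeries.coeff (rowExponent ν) (toSeries F (P μ)) ≠ 0 → Dominates μ ν) ∧
  (∀ μ ν, μ ≠ ν → pairing q t (P μ) (P ν : MvPowerSeries ℕ+ F) = 0)

/-- The Macdonald symmetric functions `P_μ(q,t)`. -/
def macdonaldP (q t : F) : YoungDiagram → Sym F :=
  Classical.epsilon (IsMacdonaldFamily q t)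

/-- The interpolation node `X_N(λ) = (q ^ (-λ_1), q ^ (-λ_2) t, …, q ^ (-λ_N) t ^ (N-1))`. -/
def node (q t : F) (N : ℕ) (lam : YoungDiagram) : Fin N → F :=
  fun i => q ^ (-(lam.rowLen i : ℤ)) * t ^ (i : ℕ)

/-- The defining properties of the interpolation Macdonald polynomial `I_{μ|N}(q,t)`, including
the normalization `I_{μ|N} = P_{μ|N} + lower degree terms`. -/
structure IsInterpPoly (q t : F) (N : ℕ) (μ : YoungDiagram) (f : MvPolynomial (Fin N) F) :
    Prop where
  symmetric : f.IsSymmetric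
  degree : f.totalDegree = μ.card
  vanishing : ∀ lam : YoungDiagram, length lam ≤ N → lam ≠ μ → lam.card ≤ μ.card →
    MvPolynomial.eval (node q t N lam) f = 0
  nonvanishing : MvPolynomial.eval (node q t N μ) f ≠ 0
  leading : MvPolynomial.homogeneousComponent μ.card f = restrict F N (macdonaldP q t μ)

/-- The interpolation Macdonald polynomial `I_{μ|N}(q,t)`, for `ℓ(μ) ≤ N`. -/
def interpPoly (q t : F) (N : ℕ) (μ : YoungDiagram) : MvPolynomial (Fin N) F :=
  Classical.epsilon (IsInterpPoly q t N μ)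

/-- The morphism `φ_N` with `φ_N(p_n) = x_1 ^ n + ⋯ + x_N ^ n + t ^ (N n) / (1 - t ^ n)`, the
regularized specialization `x_i = t ^ (i - 1)` for `i > N`. -/
def phi (t : F) (N : ℕ) : Sym F →ₐ[F] MvPolynomial (Fin N) F :=
  MvPolynomial.aeval fun n : ℕ+ =>
    MvPolynomial.psum (Fin N) F n + MvPolynomial.C (t ^ (N * (n : ℕ)) / (1 - t ^ (n : ℕ)))

/-- The defining property of the interpolation symmetric function `I_μ(q,t)`. -/
def IsInterpFunction (q t : F) (μ : YoungDiagram) (f : Sym F) : Prop :=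
  ∀ N : ℕ, 1 ≤ N → length μ ≤ N → phi t N f = interpPoly q t N μ

/-- The interpolation Macdonald symmetric function `I_μ(q,t)`. -/
def interpFunction (q t : F) (μ : YoungDiagram) : Sym F :=
  Classical.epsilon (IsInterpFunction q t μ)

/-- The defining property of the dual interpolation function `H_ν(q,t)`:
`⟨I_μ, H_ν⟩_{q,t} = δ_{μν}` for all `μ`. -/
def IsDualFunction (q t : F) (ν : YoungDiagram) (h : SymHat F) : Prop :=
  pairing q t (interpFunction q t ν) h = 1 ∧
    ∀ μ : YoungDiagram, μ ≠ ν → pairing q t (interpFunction q t μ) h = 0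

/-- The dual interpolation function `H_ν(q,t)`. -/
def dualFunction (q t : F) (ν : YoungDiagram) : SymHat F :=
  Classical.epsilon (IsDualFunction q t ν)

/-- The infinite product `(z; q)_∞ = ∏_{n ≥ 0} (1 - z q ^ n)`, understood as the power series
`exp (- ∑_{m ≥ 1} z ^ m / (m (1 - q ^ m)))` in `z`. -/
def qPochhammerInf [CharZero F] (q : F) : PowerSeries F :=
  (PowerSeries.exp F).subst
    (PowerSeries.mk fun m : ℕ => if m = 0 then (0 : F) else -(1 / ((m : F) * (1 - q ^ m))))

/-- The truncated modified dual function
`H̃_{μ|N}(u_1, …, u_N; q, t) = H_{μ|N}(y_1, …, y_N; q, t) ∏_j (y_j; q)_∞`,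
a formal power series in the variables `y_j = u_j ^ (-1)`. -/
def modifiedDual [CharZero F] (q t : F) (N : ℕ) (μ : YoungDiagram) : MvPowerSeries (Fin N) F :=
  restrictHat F N (dualFunction q t μ) *
    ∏ j : Fin N, (qPochhammerInf q).subst (MvPowerSeries.X j : MvPowerSeries (Fin N) F)

end Functions

/-! ### Dual multiparameter Schur functions -/

section DualSchur

variable {K : Type*} [Field K]

/-- `(x | c_0, c_1, …)^m = (x - c_0) ⋯ (x - c_{m-1})`. -/
def shiftedPow (x : K) (c : ℕ → K) (m : ℕ) : K := ∏ k ∈ Finset.range m, (x - c k)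

/-- The Schur-type function `f_{μ|N}(z_1, …, z_N)` attached to a sequence `f_0, f_1, …`:
the ratio of `det [f_{μ_i + N - i}(z_j)]` and `det [f_{N - i}(z_j)]` if `ℓ(μ) ≤ N`, and zero
otherwise. -/
def schurType (f : ℕ → K → K) (N : ℕ) (μ : YoungDiagram) (z : Fin N → K) : K :=
  if length μ ≤ N then
    (Matrix.of fun i j : Fin N => f (μ.rowLen i + (N - 1 - (i : ℕ))) (z j)).det /
      (Matrix.of fun i j : Fin N => f (N - 1 - (i : ℕ)) (z j)).det
  else 0

/-- The dual multiparameter Schur function `σ_{μ|N}(u_1, …, u_N | c_0, c_1, …)`, the Schur-type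
function of the sequence `1 / (u | c_0, c_1, …)^m`. -/
def sigma (N : ℕ) (μ : YoungDiagram) (u : Fin N → K) (c : ℕ → K) : K :=
  schurType (fun m x => 1 / shiftedPow x c m) N μ u

end DualSchur

end InterpMac

end

/-! Everything rests on the series G(X) = exp(Σ_{n≥1} (p_n - a_n) X^n / n) over `Sym F`
(`genSeries`) and on the series X^l / ((1 - c_0 X)⋯(1 - c_{l-1} X)) (`dualPow`), which at X = 1/u
become 1 / ((u - c_0)⋯(u - c_{l-1})). Expand G times such series, with c = (e_{N-2}, e_{N-3}, …), in
the same series. The minor of the resulting matrix with rows N-1, …, 0 and columns μ_k + N - k does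
not depend on N ≥ ℓ(μ); it is the function `multiSchur`.

Evaluation side: under p_n ↦ Σ x_k^n + a_n - Σ_{k<N} e_k^n the series G becomes ∏ (1 - e_k X)/(1 -
x_k X), and the Newton expansion of (1 - e_{N-1} X)/(1 - x_i X) turns the minor into a ratio of
alternants in the products (x - e_{N-1})(x - e_{N-2})⋯ (`det_fallingMatrix`). For e_k = q^k and a_n
= 1/(1 - q^n) the evaluation is φ_N and the ratio is a factorial Schur polynomial with the required
zeros, so `multiSchur` is I_μ (`interpFunction_eq`). For e = a = 0 it is the Schur function, which
is the Macdonald function at t = q (`macdonaldP_eq`).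

Dual side: multiply G(y_1)⋯G(y_N) by the staircase determinant of the series `dualPow` in the y_k
and expand by columns; the coefficients are the functions `multiSchur`, up to sign. A functional
dual to one of them therefore returns the determinant attached to μ
(`functionalSeries_mul_dualDet`). At t = q the scalar product has the kernel exp(Σ p_n(x) p_n(y)/n),
so pairing H_μ with G(y_1)⋯G(y_N) gives H_μ(y) times ∏ (y_j; q)_∞, the latter coming from the
constants a_n (`restrictHat_mul_qPochhammerInf`). Division by the nonzero staircase determinant
gives the formula. -/

noncomputable section
namespace InterpMac

open PowerSeries

/-! ### Expansion of power series in X^l / ((1 - c_0 X)⋯(1 - c_{l-1} X)). -/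

section Expansion

variable {R S : Type*} [CommRing R] [CommRing S]

/-- The geometric series `1 / (1 - c X)`. -/
def geom (c : R) : PowerSeries R := PowerSeries.mk fun n => c ^ n

theorem geom_mul (c : R) : geom c * (1 - C c * X) = 1 := by
  ext n
  rcases n with _ | n
  · simp [geom]
  · rw [mul_sub, mul_one, ← mul_assoc, map_sub, coeff_succ_mul_X, mul_comm, coeff_C_mul]
    simp [geom, coeff_one, pow_succ']

theorem mul_geom (c : R) : (1 - C c * X) * geom c = 1 := by rw [mul_comm, geom_mul]

theorem geom_eq (c : R) : geom c = 1 + C c * X * geom c := by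
  linear_combination geom_mul c

theorem map_geom (φ : R →+* S) (c : R) : PowerSeries.map φ (geom c) = geom (φ c) := by
  ext n; simp [geom]

/-- The series `X ^ l / ((1 - c₀ X) ⋯ (1 - c_{l-1} X))`. -/
def dualPow (c : ℕ → R) (l : ℕ) : PowerSeries R := ∏ k ∈ Finset.range l, (X * geom (c k))

theorem dualPow_zero (c : ℕ → R) : dualPow c 0 = 1 := by simp [dualPow]

theorem dualPow_succ (c : ℕ → R) (l : ℕ) :
    dualPow c (l + 1) = dualPow c l * (X * geom (c l)) := by
  rw [dualPow, Finset.prod_range_succ]; rfl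

theorem dualPow_succ' (c : ℕ → R) (l : ℕ) :
    dualPow c (l + 1) = X * geom (c 0) * dualPow (fun k => c (k + 1)) l := by
  rw [dualPow, Finset.prod_range_succ', mul_comm]; rfl

theorem map_dualPow (φ : R →+* S) (c : ℕ → R) (l : ℕ) :
    PowerSeries.map φ (dualPow c l) = dualPow (fun k => φ (c k)) l := by
  simp [dualPow, map_prod, map_geom]

theorem dualPow_eq (c : ℕ → R) (l : ℕ) :
    dualPow c l = X ^ l * ∏ k ∈ Finset.range l, geom (c k) := by
  simp [dualPow, Finset.prod_mul_distrib]

theorem X_pow_dvd_dualPow (c : ℕ → R) (l : ℕ) : X ^ l ∣ dualPow c l := by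
  rw [dualPow_eq]; exact dvd_mul_right _ _

theorem coeff_dualPow_of_lt (c : ℕ → R) {n l : ℕ} (h : n < l) : coeff n (dualPow c l) = 0 :=
  X_pow_dvd_iff.1 (X_pow_dvd_dualPow c l) n h

theorem coeff_dualPow_self (c : ℕ → R) (l : ℕ) : coeff l (dualPow c l) = 1 := by
  rw [dualPow_eq, coeff_X_pow_mul', if_pos le_rfl, Nat.sub_self, coeff_zero_eq_constantCoeff,
    map_prod]
  refine Finset.prod_eq_one fun k _ => ?_
  rw [← coeff_zero_eq_constantCoeff_apply]; simp [geom]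

theorem dualPow_zero_sequence (l : ℕ) : dualPow (fun _ => (0 : R)) l = X ^ l := by
  have : geom (0 : R) = 1 := by ext n; rcases n with _ | n <;> simp [geom, coeff_one]
  simp [dualPow, this]

/-- `a` is the sequence of coefficients of the expansion of `A` in the series `dualPow c`. -/
def IsExpansion (c : ℕ → R) (A : PowerSeries R) (a : ℕ → R) : Prop :=
  ∀ D : ℕ, X ^ D ∣ A - ∑ l ∈ Finset.range D, C (a l) * dualPow c l

theorem IsExpansion.coeff_eq {c : ℕ → R} {A : PowerSeries R} {a : ℕ → R}
    (h : IsExpansion c A a) {n D : ℕ} (hn : n < D) :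
    coeff n A = ∑ l ∈ Finset.range D, a l * coeff n (dualPow c l) := by
  have := X_pow_dvd_iff.1 (h D) n hn
  rw [map_sub, sub_eq_zero, map_sum] at this
  simpa using this

theorem IsExpansion.unique {c : ℕ → R} {A : PowerSeries R} {a b : ℕ → R}
    (ha : IsExpansion c A a) (hb : IsExpansion c A b) : a = b := by
  funext n
  induction n using Nat.strong_induction_on with
  | _ n ih =>
    have h := (ha.coeff_eq n.lt_succ_self).symm.trans (hb.coeff_eq n.lt_succ_self)
    rw [Finset.sum_range_succ, Finset.sum_range_succ, coeff_dualPow_self, mul_one, mul_one,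
      Finset.sum_congr rfl fun l hl => by rw [ih l (Finset.mem_range.1 hl)]] at h
    exact add_left_cancel h

/-- The coefficients of the expansion of `A` in the series `dualPow c`. -/
def expansionCoeff (c : ℕ → R) (A : PowerSeries R) (n : ℕ) : R :=
  coeff n A - ∑ l : Fin n, expansionCoeff c A l * coeff n (dualPow c l)

theorem isExpansion_expansionCoeff (c : ℕ → R) (A : PowerSeries R) :
    IsExpansion c A (expansionCoeff c A) := by
  intro D
  rw [X_pow_dvd_iff]
  intro n hn
  have h : ∑ l ∈ Finset.range D, expansionCoeff c A l * coeff n (dualPow c l) =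
      ∑ l ∈ Finset.range (n + 1), expansionCoeff c A l * coeff n (dualPow c l) := by
    symm
    refine Finset.sum_subset (Finset.range_subset_range.2 hn) fun l _ hl => ?_
    rw [coeff_dualPow_of_lt c (by simpa using hl), mul_zero]
  have h2 := expansionCoeff.eq_1 c A n
  rw [map_sub, map_sum]
  simp only [coeff_C_mul]
  rw [h, Finset.sum_range_succ, coeff_dualPow_self, mul_one, Finset.sum_range]
  rw [h2]; ring

theorem IsExpansion.eq_expansionCoeff {c : ℕ → R} {A : PowerSeries R} {a : ℕ → R}
    (h : IsExpansion c A a) : a = expansionCoeff c A :=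
  h.unique (isExpansion_expansionCoeff c A)

theorem IsExpansion.map (φ : R →+* S) {c : ℕ → R} {A : PowerSeries R} {a : ℕ → R}
    (h : IsExpansion c A a) :
    IsExpansion (fun k => φ (c k)) (PowerSeries.map φ A) (fun k => φ (a k)) := by
  intro D
  have := map_dvd (PowerSeries.map φ) (h D)
  simpa [map_dualPow] using this

theorem IsExpansion.C_mul {c : ℕ → R} {A : PowerSeries R} {a : ℕ → R} (b : R)
    (h : IsExpansion c A a) : IsExpansion c (C b * A) (fun l => b * a l) := by
  intro D
  have := (h D).mul_left (C b)
  rw [mul_sub, Finset.mul_sum] at this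
  simpa [mul_assoc] using this

theorem IsExpansion.sum {ι : Type*} (s : Finset ι) {c : ℕ → R} {A : ι → PowerSeries R}
    {a : ι → ℕ → R} (h : ∀ i, IsExpansion c (A i) (a i)) :
    IsExpansion c (∑ i ∈ s, A i) (fun l => ∑ i ∈ s, a i l) := by
  intro D
  have := Finset.dvd_sum (s := s) fun i _ => h i D
  rw [Finset.sum_sub_distrib, Finset.sum_comm] at this
  simpa [Finset.sum_mul] using this

/-- Multiplication by X/(1 - c_0 X) moves the series of the shifted sequence to those of c, one
index higher. This yields the stability of the determinants in N. -/
theorem IsExpansion.shift {c : ℕ → R} {A : PowerSeries R} {a : ℕ → R}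
    (h : IsExpansion (fun k => c (k + 1)) A a) :
    IsExpansion c (X * geom (c 0) * A) (fun l => Nat.casesOn l 0 a) := by
  intro D
  rcases D with _ | D
  · simp
  · rw [Finset.sum_range_succ']
    have h2 : X * geom (c 0) * A - (∑ l ∈ Finset.range D, C (a l) * dualPow c (l + 1) +
        C 0 * dualPow c 0) = geom (c 0) * (X *
          (A - ∑ l ∈ Finset.range D, C (a l) * dualPow (fun k => c (k + 1)) l)) := by
      simp only [dualPow_succ', map_zero, zero_mul, add_zero, mul_sub, Finset.mul_sum]
      congr 1
      · ring
      · exact Finset.sum_congr rfl fun l _ => by ring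
    change _ ∣ X * geom (c 0) * A - (∑ l ∈ Finset.range D, C (a l) * dualPow c (l + 1) +
        C 0 * dualPow c 0)
    rw [h2, pow_succ']
    exact (mul_dvd_mul_left X (h D)).mul_left _

/-- The sequence `c` with `b` put in front. -/
def consSeq (b : R) (c : ℕ → R) (k : ℕ) : R := Nat.casesOn k b c

/-- The remainder of Newton's expansion is known exactly: after D + 1 terms it is a multiple of X *
`dualPow c D`, hence of X^(D+1). -/
theorem isExpansion_newton (b z : R) (c : ℕ → R) :
    IsExpansion c ((1 - C b * X) * geom z)
      (fun l => ∏ k ∈ Finset.range l, (z - consSeq b c k)) := by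
  have key : ∀ D : ℕ, (1 - C b * X) - (1 - C z * X) * ∑ l ∈ Finset.range (D + 1),
      C (∏ k ∈ Finset.range l, (z - consSeq b c k)) * dualPow c l =
      C (∏ k ∈ Finset.range (D + 1), (z - consSeq b c k)) * (X * dualPow c D) := by
    intro D
    induction D with
    | zero => simp [dualPow_zero, consSeq]; ring
    | succ D ih =>
      rw [Finset.sum_range_succ, mul_add, ← sub_sub, ih, Finset.prod_range_succ _ (D + 1),
        dualPow_succ, map_mul, map_sub]
      have : C (consSeq b c (D + 1)) * X * geom (c D) = geom (c D) - 1 := by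
        rw [eq_sub_iff_add_eq, add_comm]; exact (geom_eq (c D)).symm
      linear_combination (C (∏ k ∈ Finset.range (D + 1), (z - consSeq b c k)) *
        (X * dualPow c D)) * this
  intro D
  rcases D with _ | D
  · simp
  · have h : (1 - C b * X) * geom z - ∑ l ∈ Finset.range (D + 1),
        C (∏ k ∈ Finset.range l, (z - consSeq b c k)) * dualPow c l = geom z *
        (C (∏ k ∈ Finset.range (D + 1), (z - consSeq b c k)) * (X * dualPow c D)) := by
      rw [← key]
      linear_combination (∑ l ∈ Finset.range (D + 1),
        C (∏ k ∈ Finset.range l, (z - consSeq b c k)) * dualPow c l) * (mul_geom z)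
    rw [h, pow_succ']
    exact ((mul_dvd_mul_left X (X_pow_dvd_dualPow c D)).mul_left _).mul_left _

/-- Partial fractions, peeling off one factor at a time: (1 - xX)/(1 - c_0 X) = 1 + (c_0 - x) X/(1 -
c_0 X), and `h2` returns from the shifted sequence to c at the cost of one more term. -/
theorem exists_dualPow_sum (n : ℕ) (c : ℕ → R) (x : Fin n → R) :
    ∃ b : ℕ → R, (∏ k, (1 - C (x k) * X)) * ∏ k ∈ Finset.range n, geom (c k) =
      ∑ j ∈ Finset.range (n + 1), C (b j) * dualPow c j := by
  induction n generalizing c with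
  | zero => exact ⟨fun _ => 1, by simp [dualPow_zero]⟩
  | succ n ih =>
    obtain ⟨b, hb⟩ := ih (fun k => c (k + 1)) (fun k => x k.succ)
    rw [Fin.prod_univ_succ, Finset.prod_range_succ']
    have h1 : (1 - C (x 0) * X) * geom (c 0) = 1 + C (c 0 - x 0) * (X * geom (c 0)) := by
      rw [map_sub]; linear_combination geom_eq (c 0)
    have h2 : ∀ j, dualPow (fun k => c (k + 1)) j =
        dualPow c j + C (c j - c 0) * dualPow c (j + 1) := by
      intro j
      have e1 : dualPow (fun k => c (k + 1)) j * (X * geom (c 0)) = dualPow c (j + 1) := by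
        rw [dualPow_succ', mul_comm]
      have e2 := dualPow_succ c j
      have e3 : dualPow (fun k => c (k + 1)) j = dualPow c j * geom (c j) - C (c 0) *
          dualPow c (j + 1) := by
        have e4 : dualPow (fun k => c (k + 1)) j * geom (c 0) = dualPow c j * geom (c j) := by
          rw [dualPow_eq, dualPow_eq, mul_assoc, mul_assoc, ← Finset.prod_range_succ,
            ← Finset.prod_range_succ' (fun k => geom (c k))]
        rw [← e4, ← e1]
        linear_combination (-dualPow (fun k => c (k + 1)) j) * mul_geom (c 0)
      rw [e3, map_sub, e2]
      linear_combination (dualPow c j) * geom_eq (c j)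
    -- The terms in b (j-1) come from `h2` and from `h1`. The cutoff is needed because b is
    -- unconstrained beyond n, while the new sum has one more term.
    refine ⟨fun j => (if j ≤ n then b j else 0) + Nat.casesOn j 0 fun i =>
      b i * (c i - c 0) + b i * (c 0 - x 0), ?_⟩
    have h3 : (1 - C (x 0) * X) * (∏ i : Fin n, (1 - C (x i.succ) * X)) *
        ((∏ k ∈ Finset.range n, geom (c (k + 1))) * geom (c 0)) =
        (1 + C (c 0 - x 0) * (X * geom (c 0))) *
          ∑ j ∈ Finset.range (n + 1), C (b j) * dualPow (fun k => c (k + 1)) j := by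
      rw [← hb, ← h1]; ring
    rw [h3]
    simp only [map_add, add_mul, Finset.sum_add_distrib]
    have h4 : ∑ j ∈ Finset.range (n + 1 + 1), (C (if j ≤ n then b j else 0) : PowerSeries R) *
        dualPow c j = ∑ j ∈ Finset.range (n + 1), C (b j) * dualPow c j := by
      rw [Finset.sum_range_succ, if_neg (by omega), map_zero, zero_mul, add_zero]
      exact Finset.sum_congr rfl fun j hj => by
        rw [if_pos (Nat.lt_succ_iff.1 (Finset.mem_range.1 hj))]
    rw [h4, Finset.sum_range_succ' (n := n + 1)]
    have h5 : (C (0 : R) : PowerSeries R) * dualPow c 0 = 0 := by simp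
    refine Eq.trans ?_ (congrArg₂ (· + ·) rfl (congrArg₂ (· + ·) rfl h5.symm))
    rw [add_zero, one_mul, Finset.mul_sum, ← Finset.sum_add_distrib, ← Finset.sum_add_distrib]
    refine Finset.sum_congr rfl fun j _ => ?_
    simp only [map_add, map_mul]
    linear_combination C (b j) * h2 j - C (b j) * C (c 0 - x 0) * dualPow_succ' c j

end Expansion

/-! ### First-order linear differential equations for power series -/

section Differential

variable {R S : Type*} [CommRing R] [CommRing S]

theorem derivative_map (φ : R →+* S) (A : PowerSeries R) :
    derivative S (PowerSeries.map φ A) = PowerSeries.map φ (derivative R A) := by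
  ext n; simp [coeff_derivative]

/-- The equation determines (n+1) times the coefficient of X^(n+1) from the lower ones. The term Q
is needed later for derivatives with respect to p_n. -/
theorem eq_of_derivative_eq [IsAddTorsionFree R] {A B P Q : PowerSeries R}
    (hA : derivative R A = P * A + Q) (hB : derivative R B = P * B + Q)
    (h0 : constantCoeff A = constantCoeff B) : A = B := by
  ext n
  induction n using Nat.strong_induction_on with
  | _ n ih =>
    rcases n with _ | n
    · simpa using h0
    · have h1 := congrArg (coeff n) hA
      have h2 := congrArg (coeff n) hB
      have h3 : coeff n (P * A) = coeff n (P * B) := by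
        rw [coeff_mul, coeff_mul]
        refine Finset.sum_congr rfl fun x hx => ?_
        rw [ih x.2 (by have := Finset.HasAntidiagonal.mem_antidiagonal.1 hx; omega)]
      rw [map_add, h3, ← map_add, ← h2, coeff_derivative, coeff_derivative] at h1
      have h4 : (n + 1) • coeff (n + 1) A = (n + 1) • coeff (n + 1) B := by
        simpa [nsmul_eq_mul, mul_comm] using h1
      exact nsmul_right_injective (Nat.succ_ne_zero n) h4

/-- The exponential of a power series without constant term. -/
def expSeries [Algebra ℚ R] (f : PowerSeries R) : PowerSeries R := (exp R).subst f

theorem derivative_expSeries [Algebra ℚ R] {f : PowerSeries R} (hf : constantCoeff f = 0) :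
    derivative R (expSeries f) = derivative R f * expSeries f := by
  rw [expSeries, derivative_subst (HasSubst.of_constantCoeff_zero' hf), derivative_exp, mul_comm]

theorem constantCoeff_expSeries [Algebra ℚ R] {f : PowerSeries R} (hf : constantCoeff f = 0) :
    constantCoeff (expSeries f) = 1 := by
  have := coeff_subst' (HasSubst.of_constantCoeff_zero' hf) (exp R) 0
  rw [expSeries, ← coeff_zero_eq_constantCoeff_apply, this, finsum_eq_single _ 0]
  · simp
  · intro n hn; simp [hf, hn]

end Differential
end InterpMac
end

noncomputable section
set_option linter.unusedSectionVars false
namespace InterpMac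

open PowerSeries

/-! ### The generating series of shifted complete homogeneous functions -/

section GeneratingSeries

theorem derivative_geom {R : Type*} [CommRing R] (c : R) :
    derivative R (geom c) = C c * geom c * geom c := by
  have h := congrArg (derivative R) (geom_mul c)
  rw [derivative_one, Derivation.leibniz, map_sub, derivative_one, Derivation.leibniz,
    derivative_X, derivative_C] at h
  simp only [smul_eq_mul] at h
  linear_combination (geom c) * h - (derivative R (geom c)) * geom_mul c

theorem derivative_prod {R ι : Type*} [CommRing R] (s : Finset ι) (A P : ι → PowerSeries R)
    (h : ∀ i, derivative R (A i) = P i * A i) :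
    derivative R (∏ i ∈ s, A i) = (∑ i ∈ s, P i) * ∏ i ∈ s, A i := by
  classical
  induction s using Finset.induction_on with
  | empty => simp
  | insert i s hi ih =>
    rw [Finset.prod_insert hi, Finset.sum_insert hi, Derivation.leibniz, ih, h]
    simp only [smul_eq_mul]; ring

variable {F : Type*} [Field F] [CharZero F]

/-- The exponent of `genSeries`. -/
def genExponent (a : ℕ → F) : PowerSeries (Sym F) :=
  PowerSeries.mk fun n => if h : 0 < n then
    MvPolynomial.C (1 / (n : F)) * (MvPolynomial.X ⟨n, h⟩ - MvPolynomial.C (a n)) else 0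

/-- The series `∑ (p_{n+1} - a_{n+1}) X ^ n`. -/
def genLogDeriv (a : ℕ → F) : PowerSeries (Sym F) :=
  PowerSeries.mk fun n => MvPolynomial.X n.succPNat - MvPolynomial.C (a (n + 1))

theorem derivative_genExponent (a : ℕ → F) :
    derivative _ (genExponent a) = genLogDeriv a := by
  ext1 n
  rw [coeff_derivative, genExponent, genLogDeriv, coeff_mk, coeff_mk, dif_pos n.succ_pos]
  have h : ((n : Sym F) + 1) = MvPolynomial.C ((n : F) + 1) := by simp
  have h2 : (MvPolynomial.C (1 / ((n + 1 : ℕ) : F)) : Sym F) * MvPolynomial.C ((n : F) + 1) = 1 := by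
    rw [← map_mul, Nat.cast_add_one, one_div_mul_cancel (Nat.cast_add_one_ne_zero n), map_one]
  rw [h]
  change _ * (MvPolynomial.X n.succPNat - _) * _ = _
  linear_combination (MvPolynomial.X n.succPNat - MvPolynomial.C (a (n + 1))) * h2

/-- The generating series `exp (∑_{n ≥ 1} (p_n - a_n) X ^ n / n)` of (shifted) complete homogeneous
symmetric functions. -/
def genSeries (a : ℕ → F) : PowerSeries (Sym F) := expSeries (genExponent a)

theorem constantCoeff_genExponent (a : ℕ → F) : constantCoeff (genExponent a) = 0 := by
  rw [← coeff_zero_eq_constantCoeff_apply, genExponent, coeff_mk, dif_neg (lt_irrefl 0)]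

theorem constantCoeff_genSeries (a : ℕ → F) : constantCoeff (genSeries a) = 1 :=
  constantCoeff_expSeries (constantCoeff_genExponent a)

theorem derivative_genSeries (a : ℕ → F) :
    derivative _ (genSeries a) = genLogDeriv a * genSeries a := by
  rw [genSeries, derivative_expSeries (constantCoeff_genExponent a), derivative_genExponent]

/-- The homomorphism `p_n ↦ x_1 ^ n + ⋯ + x_N ^ n + a_n - ∑_{k < N} e_k ^ n`. -/
def evalShift (e : ℤ → F) (a : ℕ → F) (N : ℕ) : Sym F →ₐ[F] MvPolynomial (Fin N) F :=
  MvPolynomial.aeval fun n : ℕ+ =>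
    MvPolynomial.psum (Fin N) F n + MvPolynomial.C (a n - ∑ k : Fin N, e (k : ℕ) ^ (n : ℕ))

/-- Both sides have constant term 1 and the same logarithmic derivative, with coefficients Σ
x_k^(n+1) - Σ e_k^(n+1); the constants a_n cancel. -/
theorem map_genSeries (e : ℤ → F) (a : ℕ → F) (N : ℕ) :
    PowerSeries.map (evalShift e a N : Sym F →+* MvPolynomial (Fin N) F) (genSeries a) =
      ∏ k : Fin N, ((1 - C (MvPolynomial.C (e (k : ℕ))) * X) * geom (MvPolynomial.X k)) := by
  refine eq_of_derivative_eq (P := PowerSeries.map (evalShift e a N : Sym F →+* _)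
    (genLogDeriv a)) (Q := 0) ?_ ?_ ?_
  · rw [derivative_map, derivative_genSeries, map_mul, add_zero]
  · rw [add_zero, derivative_prod _ _ (fun k : Fin N => C (MvPolynomial.X k) *
      geom (MvPolynomial.X k) - C (MvPolynomial.C (e (k : ℕ))) *
        geom (MvPolynomial.C (e (k : ℕ))))]
    · congr 1
      ext1 n
      rw [coeff_map, genLogDeriv, coeff_mk, map_sum]
      simp only [map_sub, coeff_C_mul, geom, coeff_mk, ← pow_succ']
      rw [Finset.sum_sub_distrib]
      simp only [RingHom.coe_coe, map_sub, evalShift, MvPolynomial.aeval_X, MvPolynomial.psum,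
        MvPolynomial.algHom_C, map_sum, map_pow, Nat.succPNat_coe, Nat.succ_eq_add_one,
        MvPolynomial.algebraMap_eq]
      ring
    · intro k
      have h := mul_geom (MvPolynomial.C (e (k : ℕ)) : MvPolynomial (Fin N) F)
      rw [Derivation.leibniz, derivative_geom, map_sub, derivative_one, Derivation.leibniz,
        derivative_X, derivative_C]
      simp only [smul_eq_mul]
      linear_combination (C (MvPolynomial.C (e (k : ℕ))) * geom (MvPolynomial.X k)) * h
  · rw [← coeff_zero_eq_constantCoeff_apply, coeff_map, coeff_zero_eq_constantCoeff_apply,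
      constantCoeff_genSeries, map_one, map_prod]
    symm
    refine Finset.prod_eq_one fun k _ => ?_
    rw [← coeff_zero_eq_constantCoeff_apply]; simp [geom]

end GeneratingSeries

/-! ### Multiparameter Schur functions as minors, and their ratio-of-alternants formula -/

section SchurFunctions

variable {F : Type*} [Field F] [CharZero F]

/-- The sequence `e_s, e_{s-1}, …` as constants of the algebra of symmetric functions. -/
def constSeq (e : ℤ → F) (s : ℤ) (k : ℕ) : Sym F := MvPolynomial.C (e (s - k))

theorem constSeq_succ (e : ℤ → F) (s : ℤ) :
    (fun k => constSeq e (s + 1) (k + 1)) = constSeq e s := by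
  funext k
  rw [constSeq, constSeq]; congr 2; push_cast; ring

/-- The matrix of the multiplication by `genSeries` in the basis `dualPow`. -/
def genMatrix (e : ℤ → F) (a : ℕ → F) (s : ℤ) (j : ℕ) : ℕ → Sym F :=
  expansionCoeff (constSeq e s) (genSeries a * dualPow (constSeq e s) j)

theorem isExpansion_genMatrix (e : ℤ → F) (a : ℕ → F) (s : ℤ) (j : ℕ) :
    IsExpansion (constSeq e s) (genSeries a * dualPow (constSeq e s) j) (genMatrix e a s j) :=
  isExpansion_expansionCoeff _ _

theorem genMatrix_zero_right (e : ℤ → F) (a : ℕ → F) (s : ℤ) (j : ℕ) :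
    genMatrix e a s j 0 = if j = 0 then 1 else 0 := by
  have h := (isExpansion_genMatrix e a s j).coeff_eq (n := 0) (D := 1) one_pos
  rw [Finset.sum_range_one, coeff_dualPow_self, mul_one] at h
  rw [← h, coeff_mul, Finset.Nat.antidiagonal_zero, Finset.sum_singleton,
    coeff_zero_eq_constantCoeff_apply, constantCoeff_genSeries, one_mul]
  split_ifs with hj
  · rw [hj, coeff_dualPow_self]
  · exact coeff_dualPow_of_lt _ (Nat.pos_of_ne_zero hj)

/-- Raising s by one puts a new parameter in front of the sequence, so deleting row and column 0 of
the matrix for s + 1 leaves the matrix for s. -/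
theorem genMatrix_succ_succ (e : ℤ → F) (a : ℕ → F) (s : ℤ) (j l : ℕ) :
    genMatrix e a (s + 1) (j + 1) (l + 1) = genMatrix e a s j l := by
  have h := isExpansion_genMatrix e a s j
  rw [← constSeq_succ] at h
  have h2 := h.shift
  have h3 : X * geom (constSeq e (s + 1) 0) * (genSeries a * dualPow (fun k =>
      constSeq e (s + 1) (k + 1)) j) = genSeries a * dualPow (constSeq e (s + 1)) (j + 1) := by
    rw [dualPow_succ']; ring
  rw [h3] at h2
  rw [genMatrix, ← h2.eq_expansionCoeff]

/-- The determinant of the columns of `genMatrix` given by `f`. -/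
def genDet (e : ℤ → F) (a : ℕ → F) (N : ℕ) (f : Fin N → ℕ) : Sym F :=
  (Matrix.of fun i k : Fin N => genMatrix e a ((N : ℤ) - 2) (N - 1 - (i : ℕ)) (f k)).det

/-- The last column is (0, …, 0, 1); expanding along it leaves the smaller determinant. -/
theorem genDet_succ (e : ℤ → F) (a : ℕ → F) (N : ℕ) (f : Fin N → ℕ) :
    genDet e a (N + 1) (Fin.snoc (fun k => f k + 1) 0) = genDet e a N f := by
  rw [genDet, Matrix.det_succ_column _ (Fin.last N), Fin.sum_univ_castSucc,
    Finset.sum_eq_zero, zero_add]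
  · rw [Matrix.of_apply, Fin.snoc_last, genMatrix_zero_right, if_pos (by simp)]
    rw [genDet]
    simp only [Fin.val_last, mul_one, ← two_mul, pow_mul, neg_one_sq, one_pow, one_mul]
    congr 1
    ext1 i k
    simp only [Matrix.submatrix_apply, Matrix.of_apply, Fin.succAbove_last, Fin.snoc_castSucc,
      Fin.val_castSucc]
    have hi := i.2
    rw [show N + 1 - 1 - (i : ℕ) = N - 1 - i + 1 by omega,
      show ((N + 1 : ℕ) : ℤ) - 2 = (N : ℤ) - 2 + 1 by push_cast; ring, genMatrix_succ_succ]
  · intro i _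
    have hi := i.2
    rw [Matrix.of_apply, Fin.snoc_last, genMatrix_zero_right, if_neg
      (by rw [Fin.val_castSucc]; omega)]
    simp

/-- `(z - e_{N-1}) (z - e_{N-2}) ⋯ (z - e_{N-l})`. -/
def fallingPow {R : Type*} [CommRing R] (e : ℤ → R) (N : ℕ) (z : R) (l : ℕ) : R :=
  ∏ k ∈ Finset.range l, (z - e ((N : ℤ) - 1 - k))

/-- The matrix `(x_i - e_{N-1}) ⋯ (x_i - e_{N - f k})`. -/
def fallingMatrix (e : ℤ → F) (N : ℕ) (f : Fin N → ℕ) :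
    Matrix (Fin N) (Fin N) (MvPolynomial (Fin N) F) :=
  Matrix.of fun i k => fallingPow (fun z => MvPolynomial.C (e z)) N (MvPolynomial.X i) (f k)

/-- Multiply ∏ (1 - e_k X)/(1 - x_k X) by ∏_{k≠i} (1 - x_k X) / ∏_{k<N-1} (1 - e_k X), a combination
of `dualPow` of index below N. What remains is (1 - e_{N-1} X)/(1 - x_i X), and uniqueness compares
its Newton coefficients with those from `genMatrix`. -/
theorem exists_fallingPow_eq (e : ℤ → F) (a : ℕ → F) (N : ℕ) (i : Fin N) :
    ∃ b : ℕ → MvPolynomial (Fin N) F, ∀ l,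
      fallingPow (fun z => MvPolynomial.C (e z)) N (MvPolynomial.X i) l =
        ∑ j ∈ Finset.range N, b j * evalShift e a N (genMatrix e a ((N : ℤ) - 2) j l) := by
  obtain ⟨n, rfl⟩ : ∃ n, N = n + 1 := ⟨N - 1, by have := i.2; omega⟩
  set c : ℕ → MvPolynomial (Fin (n + 1)) F := fun k => MvPolynomial.C (e (((n + 1 : ℕ) : ℤ) - 2 - k)) with hc
  obtain ⟨b, hb⟩ := exists_dualPow_sum n c (fun k => MvPolynomial.X (i.succAbove k))
  refine ⟨b, fun l => ?_⟩
  have hconst : (fun k => (evalShift e a (n + 1) : Sym F →+* _) (constSeq e (((n + 1 : ℕ) : ℤ) - 2) k)) = c := by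
    funext k; simp [constSeq, hc, MvPolynomial.algebraMap_eq]
  have h1 := IsExpansion.sum (Finset.range (n + 1)) fun j =>
    ((isExpansion_genMatrix e a (((n + 1 : ℕ) : ℤ) - 2) j).map
      (evalShift e a (n + 1) : Sym F →+* MvPolynomial (Fin (n + 1)) F)).C_mul (b j)
  have h2 := isExpansion_newton (MvPolynomial.C (e (n : ℤ))) (MvPolynomial.X i) c
  rw [hconst] at h1
  have h3 : ∑ j ∈ Finset.range (n + 1), C (b j) * PowerSeries.map
      (evalShift e a (n + 1) : Sym F →+* MvPolynomial (Fin (n + 1)) F)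
        (genSeries a * dualPow (constSeq e (((n + 1 : ℕ) : ℤ) - 2)) j) =
      (1 - C (MvPolynomial.C (e (n : ℤ))) * X) * geom (MvPolynomial.X i) := by
    simp only [map_mul, map_dualPow, hconst, map_genSeries]
    have h4 : ∀ G : PowerSeries (MvPolynomial (Fin (n + 1)) F), ∑ j ∈ Finset.range (n + 1),
        C (b j) * (G * dualPow c j) = G * ∑ j ∈ Finset.range (n + 1), C (b j) * dualPow c j := by
      intro G; rw [Finset.mul_sum]; exact Finset.sum_congr rfl fun j _ => by ring
    rw [h4, ← hb, Finset.prod_mul_distrib, Fin.prod_univ_succAbove (fun k : Fin (n + 1) => geom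
      (MvPolynomial.X k)) i, Fin.prod_univ_castSucc]
    -- The first n terms of c are e_{n-1}, …, e_0, so they cancel the numerator factors in reversed
    -- order.
    have h5 : (∏ k : Fin n, (1 - C (MvPolynomial.C (e ((k.castSucc : Fin (n + 1)) : ℕ)) :
        MvPolynomial (Fin (n + 1)) F) * X)) * ∏ k ∈ Finset.range n, geom (c k) = 1 := by
      rw [Finset.prod_range, ← Equiv.prod_comp Fin.revPerm (fun k : Fin n => geom (c k)),
        ← Finset.prod_mul_distrib]
      refine Finset.prod_eq_one fun k _ => ?_
      have : c ((Fin.revPerm k : Fin n) : ℕ) =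
          MvPolynomial.C (e ((k.castSucc : Fin (n + 1)) : ℕ)) := by
        rw [hc, Fin.revPerm_apply, Fin.val_rev, Fin.val_castSucc]
        have := k.2
        push_cast [Nat.cast_sub (show (k : ℕ) + 1 ≤ n by omega)]
        ring_nf
      rw [this, mul_geom]
    have h6 : (∏ k : Fin n, (1 - C (MvPolynomial.X (i.succAbove k) :
        MvPolynomial (Fin (n + 1)) F) * X)) * ∏ k : Fin n, geom (MvPolynomial.X (i.succAbove k)) = 1 := by
      rw [← Finset.prod_mul_distrib]
      exact Finset.prod_eq_one fun k _ => mul_geom _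
    rw [Fin.val_last]
    generalize (1 - C (MvPolynomial.C (e (n : ℤ)) : MvPolynomial (Fin (n + 1)) F) * X) = A at *
    generalize geom (MvPolynomial.X i : MvPolynomial (Fin (n + 1)) F) = B at *
    linear_combination (A * B) * h6 + (A * B * (∏ k : Fin n, (1 - C (MvPolynomial.X
      (i.succAbove k) : MvPolynomial (Fin (n + 1)) F) * X)) *
        ∏ k : Fin n, geom (MvPolynomial.X (i.succAbove k))) * h5
  rw [h3] at h1
  have h7 := congrFun (h2.unique h1) l
  refine Eq.trans ?_ h7
  rw [fallingPow]
  refine Finset.prod_congr rfl fun k _ => ?_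
  have hk : (MvPolynomial.C (e (((n + 1 : ℕ) : ℤ) - 1 - k)) : MvPolynomial (Fin (n + 1)) F) =
      consSeq (MvPolynomial.C (e (n : ℤ))) c k := by
    rcases k with _ | k
    · change _ = MvPolynomial.C (e (n : ℤ))
      congr 2; push_cast; ring
    · change _ = c k
      rw [hc]; congr 2; push_cast; ring
  rw [← hk]

/-- The coefficients of the previous lemma do not involve the columns, so their determinant is a
factor common to all f; the staircase, where `genDet` is 1, identifies it. -/
theorem exists_fallingMatrix_eq (e : ℤ → F) (a : ℕ → F) (N : ℕ) :
    ∃ b : MvPolynomial (Fin N) F, ∀ f : Fin N → ℕ,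
      (fallingMatrix e N f).det = b * evalShift e a N (genDet e a N f) := by
  choose b hb using exists_fallingPow_eq e a N
  refine ⟨(Matrix.of fun i j : Fin N => b i (N - 1 - (j : ℕ))).det, fun f => ?_⟩
  rw [genDet, AlgHom.map_det, ← Matrix.det_mul]
  congr 1
  ext1 i k
  rw [fallingMatrix, Matrix.of_apply, hb, Finset.sum_range, Matrix.mul_apply,
    ← Equiv.sum_comp Fin.revPerm]
  refine Finset.sum_congr rfl fun j _ => ?_
  have : ((Fin.revPerm j : Fin N) : ℕ) = N - 1 - j := by
    rw [Fin.revPerm_apply, Fin.val_rev]; have := j.2; omega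
  rw [this]; rfl

theorem genDet_staircase (e : ℤ → F) (a : ℕ → F) (N : ℕ) :
    genDet e a N (fun k => N - 1 - k) = 1 := by
  induction N with
  | zero => simp [genDet]
  | succ N ih =>
    rw [← ih, ← genDet_succ e a N]
    refine congrArg (genDet e a (N + 1)) (funext fun k => ?_)
    refine Fin.lastCases ?_ (fun k => ?_) k
    · simp
    · have := k.2
      rw [Fin.snoc_castSucc, Fin.val_castSucc]; omega

theorem det_fallingMatrix (e : ℤ → F) (a : ℕ → F) (N : ℕ) (f : Fin N → ℕ) :
    (fallingMatrix e N f).det =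
      (fallingMatrix e N fun k => N - 1 - k).det * evalShift e a N (genDet e a N f) := by
  obtain ⟨b, hb⟩ := exists_fallingMatrix_eq e a N
  rw [hb f, hb, genDet_staircase, map_one, mul_one]

end SchurFunctions
end InterpMac
end

noncomputable section
set_option linter.unusedSectionVars false
namespace InterpMac

/-! ### Partitions and strictly decreasing sequences -/

section Partitions

theorem rowLen_eq_zero_iff (μ : YoungDiagram) (i : ℕ) : μ.rowLen i = 0 ↔ length μ ≤ i := by
  rw [length, ← not_lt, ← YoungDiagram.mem_iff_lt_colLen, YoungDiagram.mem_iff_lt_rowLen]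
  omega

theorem eq_of_rowLen_eq {μ ν : YoungDiagram} (h : ∀ i, μ.rowLen i = ν.rowLen i) : μ = ν := by
  ext ⟨i, j⟩
  simp only [YoungDiagram.mem_cells, YoungDiagram.mem_iff_lt_rowLen, h]

theorem card_eq_sum_rowLen {μ : YoungDiagram} {N : ℕ} (h : length μ ≤ N) :
    μ.card = ∑ i ∈ Finset.range N, μ.rowLen i := by
  rw [YoungDiagram.card, Finset.card_eq_sum_card_fiberwise (f := Prod.fst) (t := Finset.range N)]
  · exact Finset.sum_congr rfl fun i _ => (YoungDiagram.rowLen_eq_card μ).symm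
  · rintro ⟨i, j⟩ hc
    have := YoungDiagram.mem_iff_lt_rowLen.1 ((YoungDiagram.mem_cells _).1 hc)
    refine Finset.mem_coe.2 (Finset.mem_range.2 (lt_of_not_ge fun hi => ?_))
    have := (rowLen_eq_zero_iff μ i).2 (h.trans hi)
    omega

theorem length_le_card (μ : YoungDiagram) : length μ ≤ μ.card := by
  rw [card_eq_sum_rowLen le_rfl]
  calc length μ = ∑ i ∈ Finset.range (length μ), 1 := by simp
    _ ≤ _ := Finset.sum_le_sum fun i hi => by
      have := mt (rowLen_eq_zero_iff μ i).1 (not_le.2 (Finset.mem_range.1 hi))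
      omega

/-- The partition with parts `r 0 ≥ r 1 ≥ ⋯`. -/
theorem exists_rowLen_eq (N : ℕ) (r : ℕ → ℕ) (hr : Antitone r) (h : ∀ i, N ≤ i → r i = 0) :
    ∃ μ : YoungDiagram, ∀ i, μ.rowLen i = r i := by
  let μ : YoungDiagram :=
    { cells := (Finset.range N ×ˢ Finset.range (r 0)).filter fun c => c.2 < r c.1
      isLowerSet := by
        rintro ⟨i, j⟩ ⟨i', j'⟩ ⟨hi, hj⟩ hc
        simp only [Finset.coe_filter, Finset.mem_product, Finset.mem_range, Set.mem_ofPred_eq] at *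
        have := hr hi
        omega }
  have hmem : ∀ i j, (i, j) ∈ μ ↔ j < r i := by
    intro i j
    rw [← YoungDiagram.mem_cells]
    simp only [μ, Finset.mem_filter, Finset.mem_product, Finset.mem_range]
    constructor
    · exact fun hc => hc.2
    · intro hj
      have := hr (Nat.zero_le i)
      exact ⟨⟨lt_of_not_ge fun hi => by have := h i hi; omega, by omega⟩, hj⟩
  refine ⟨μ, fun i => ?_⟩
  have h2 : ∀ j, j < μ.rowLen i ↔ j < r i := fun j => by
    rw [← YoungDiagram.mem_iff_lt_rowLen, hmem]
  have h3 := h2 (r i)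
  have h4 := h2 (μ.rowLen i)
  omega

/-- The strictly decreasing sequence `μ_i + N - i` attached to a partition. -/
def stair (μ : YoungDiagram) (N : ℕ) (k : Fin N) : ℕ := μ.rowLen k + (N - 1 - k)

theorem stair_strictAnti (μ : YoungDiagram) (N : ℕ) : StrictAnti (stair μ N) := by
  intro i j hij
  have h1 := μ.rowLen_anti i j (le_of_lt hij)
  have h2 := i.2
  have h3 := j.2
  have h4 : (i : ℕ) < j := hij
  rw [stair, stair]
  omega

theorem stair_bot (N : ℕ) : stair ⊥ N = fun k : Fin N => N - 1 - (k : ℕ) := by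
  funext k
  rw [stair, (rowLen_eq_zero_iff ⊥ k).2, zero_add]
  rw [length, YoungDiagram.colLen_eq_card]
  simp [YoungDiagram.col]

theorem eq_of_stair_eq {μ ν : YoungDiagram} {N : ℕ} (hμ : length μ ≤ N) (hν : length ν ≤ N)
    (h : stair μ N = stair ν N) : μ = ν := by
  refine eq_of_rowLen_eq fun i => ?_
  by_cases hi : i < N
  · have := congrFun h ⟨i, hi⟩
    simpa [stair] using this
  · rw [(rowLen_eq_zero_iff μ i).2 (by omega), (rowLen_eq_zero_iff ν i).2 (by omega)]

theorem sum_stair {μ : YoungDiagram} {N : ℕ} (h : length μ ≤ N) :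
    ∑ k, stair μ N k = μ.card + ∑ k : Fin N, (N - 1 - (k : ℕ)) := by
  rw [card_eq_sum_rowLen h, Finset.sum_range, ← Finset.sum_add_distrib]
  rfl

theorem exists_stair_comp_perm {N : ℕ} {f : Fin N → ℕ} (hf : Function.Injective f) :
    ∃ μ : YoungDiagram, length μ ≤ N ∧ ∃ w : Equiv.Perm (Fin N), f = stair μ N ∘ w := by
  set v : Equiv.Perm (Fin N) := Fin.revPerm.trans (Tuple.sort f)
  set g : Fin N → ℕ := f ∘ v with hg
  have hganti : StrictAnti g := by
    have h1 : Antitone g := fun i j hij => by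
      have := Tuple.monotone_sort f (Fin.rev_le_rev.2 hij)
      simpa [hg, v] using this
    exact h1.strictAnti_of_injective (hf.comp v.injective)
  have hstep : ∀ i : ℕ, ∀ h : i + 1 < N, g ⟨i + 1, h⟩ < g ⟨i, by omega⟩ := fun i h =>
    hganti (Fin.mk_lt_mk.2 (Nat.lt_succ_self i))
  -- A strictly decreasing sequence of N natural numbers dominates the staircase, so the truncated
  -- subtraction in `r` loses nothing.
  have hge : ∀ d i : ℕ, ∀ h : i < N, N - 1 - i = d → d ≤ g ⟨i, h⟩ := by
    intro d
    induction d with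
    | zero => intros; exact Nat.zero_le _
    | succ d ih =>
      intro i h hd
      have h1 := ih (i + 1) (by omega) (by omega)
      have h2 := hstep i (by omega)
      omega
  let r : ℕ → ℕ := fun i => if h : i < N then g ⟨i, h⟩ - (N - 1 - i) else 0
  have hr : Antitone r := antitone_nat_of_succ_le fun i => by
    by_cases h : i + 1 < N
    · have h2 := hstep i h
      have h3 := hge _ (i + 1) h rfl
      simp only [r, dif_pos h, dif_pos (show i < N by omega)]
      omega
    · simp [r, h]
  obtain ⟨μ, hμ⟩ := exists_rowLen_eq N r hr fun i hi => by simp [r, not_lt.2 hi]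
  refine ⟨μ, (rowLen_eq_zero_iff μ N).1 (by rw [hμ]; simp [r]), v.symm, ?_⟩
  have : stair μ N = g := by
    funext k
    have := hge _ k k.2 rfl
    rw [stair, hμ]
    simp only [r, dif_pos k.2, Fin.eta] at *
    omega
  rw [this, hg]
  funext k; simp

end Partitions

/-! ### Stability in the number of rows and straightening of columns -/

section SchurFunctions

variable {F : Type*} [Field F] [CharZero F]

/-- The multiparameter Schur function attached to the parameters `e` and the shift `a`. -/
def multiSchur (e : ℤ → F) (a : ℕ → F) (μ : YoungDiagram) : Sym F :=
  genDet e a (length μ) (stair μ (length μ))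

theorem genDet_stair (e : ℤ → F) (a : ℕ → F) {μ : YoungDiagram} {N : ℕ} (h : length μ ≤ N) :
    genDet e a N (stair μ N) = multiSchur e a μ := by
  induction N, h using Nat.le_induction with
  | base => rfl
  | succ N h ih =>
    rw [← ih, ← genDet_succ e a N]
    refine congrArg (genDet e a (N + 1)) (funext fun k => ?_)
    refine Fin.lastCases ?_ (fun k => ?_) k
    · rw [Fin.snoc_last, stair, Fin.val_last, (rowLen_eq_zero_iff μ N).2 h]
      omega
    · have := k.2
      rw [Fin.snoc_castSucc, stair, stair, Fin.val_castSucc]; omega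

theorem genDet_comp_perm (e : ℤ → F) (a : ℕ → F) {N : ℕ} (f : Fin N → ℕ)
    (w : Equiv.Perm (Fin N)) :
    genDet e a N (f ∘ w) = ((Equiv.Perm.sign w : ℤˣ) : ℤ) • genDet e a N f := by
  have := Matrix.det_permute' w (Matrix.of fun i k : Fin N =>
    genMatrix e a ((N : ℤ) - 2) (N - 1 - (i : ℕ)) (f k))
  rw [zsmul_eq_mul]
  exact this

theorem genDet_of_not_injective (e : ℤ → F) (a : ℕ → F) {N : ℕ} {f : Fin N → ℕ}
    (hf : ¬ Function.Injective f) : genDet e a N f = 0 := by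
  obtain ⟨i, j, hij, hne⟩ := Function.not_injective_iff.1 hf
  exact Matrix.det_zero_of_column_eq hne fun k => by simp [hij]


theorem genDet_eq_zero_or (e : ℤ → F) (a : ℕ → F) {N : ℕ} (f : Fin N → ℕ) :
    genDet e a N f = 0 ∨ ∃ μ : YoungDiagram, length μ ≤ N ∧ ∃ w : Equiv.Perm (Fin N),
      f = stair μ N ∘ w ∧ genDet e a N f = ((Equiv.Perm.sign w : ℤˣ) : ℤ) • multiSchur e a μ := by
  by_cases hf : Function.Injective f
  · obtain ⟨μ, hμ, w, rfl⟩ := exists_stair_comp_perm hf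
    exact Or.inr ⟨μ, hμ, w, rfl, by rw [genDet_comp_perm, genDet_stair e a hμ]⟩
  · exact Or.inl (genDet_of_not_injective e a hf)

end SchurFunctions
end InterpMac
end

noncomputable section
set_option linter.unusedSectionVars false
namespace InterpMac

/-! ### Coefficients of products and determinants of univariate series -/

section CoefficientLemmas

variable {R S : Type*} [CommRing R] [CommRing S] {N : ℕ}

/-- The univariate series `f` in the variable with index `k`. -/
def inVar (k : Fin N) (f : PowerSeries R) : MvPowerSeries (Fin N) R :=
  f.subst (MvPowerSeries.X k : MvPowerSeries (Fin N) R)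

theorem coeff_inVar (k : Fin N) (f : PowerSeries R) (d : Fin N →₀ ℕ) :
    MvPowerSeries.coeff d (inVar k f) =
      if d = Finsupp.single k (d k) then PowerSeries.coeff (d k) f else 0 :=
  PowerSeries.coeff_subst_single k f d

theorem inVar_mul (k : Fin N) (f g : PowerSeries R) : inVar k (f * g) = inVar k f * inVar k g :=
  PowerSeries.subst_mul (PowerSeries.HasSubst.X k) f g

theorem map_inVar (φ : R →+* S) (k : Fin N) (f : PowerSeries R) :
    MvPowerSeries.map φ (inVar k f) = inVar k (PowerSeries.map φ f) := by
  ext d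
  rw [MvPowerSeries.coeff_map, coeff_inVar, coeff_inVar, apply_ite φ, map_zero]
  rfl

theorem coeff_prod_inVar (f : Fin N → PowerSeries R) (d : Fin N →₀ ℕ) :
    MvPowerSeries.coeff d (∏ k, inVar k (f k)) = ∏ k, PowerSeries.coeff (d k) (f k) := by
  classical
  rw [MvPowerSeries.coeff_prod]
  have hsupp : ∀ l : Fin N →₀ (Fin N →₀ ℕ), l.support ⊆ Finset.univ := fun l =>
    Finset.subset_univ _
  -- The k-th factor involves only its own variable, so only one splitting of d contributes.
  rw [Finset.sum_eq_single (Finsupp.equivFunOnFinite.symm fun k => Finsupp.single k (d k))]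
  · refine Finset.prod_congr rfl fun k _ => ?_
    rw [Finsupp.equivFunOnFinite_symm_apply_apply, coeff_inVar, Finsupp.single_eq_same,
      if_pos rfl]
  · intro l hl hne
    rw [Finset.mem_finsuppAntidiag] at hl
    by_contra hprod
    apply hne
    have h1 : ∀ k, l k = Finsupp.single k (l k k) := by
      intro k
      by_contra hk
      refine hprod (Finset.prod_eq_zero (Finset.mem_univ k) ?_)
      rw [coeff_inVar, if_neg hk]
    ext1 k
    rw [Finsupp.equivFunOnFinite_symm_apply_apply, h1 k]
    congr 1
    rw [← hl.1, Finsupp.finsetSum_apply, Finset.sum_eq_single k]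
    · intro j _ hj
      rw [h1 j, Finsupp.single_eq_of_ne hj.symm]
    · simp
  · intro h
    refine absurd ?_ h
    rw [Finset.mem_finsuppAntidiag]
    refine ⟨?_, hsupp _⟩
    ext j
    simp

theorem coeff_det_inVar (f : Fin N → PowerSeries R) (d : Fin N →₀ ℕ) :
    MvPowerSeries.coeff d (Matrix.of fun i k : Fin N => inVar k (f i)).det =
      (Matrix.of fun i k : Fin N => PowerSeries.coeff (d k) (f i)).det := by
  rw [Matrix.det_apply, Matrix.det_apply, map_sum]
  refine Finset.sum_congr rfl fun w _ => ?_
  rw [Units.smul_def, Units.smul_def, map_zsmul]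
  congr 1
  exact coeff_prod_inVar (fun k => f (w k)) d

theorem det_sum_columns {D : ℕ} (M : Fin N → Fin D → R) (g : Fin D → Fin N → R) :
    (Matrix.of fun i k : Fin N => ∑ l, M i l * g l k).det =
      ∑ f : Fin N → Fin D, (Matrix.of fun i k : Fin N => M i (f k)).det * ∏ k, g (f k) k := by
  rw [← Matrix.det_transpose]
  have h := (Matrix.detRowAlternating (R := R) (n := Fin N)).toMultilinearMap.map_sum
    (fun (k : Fin N) (l : Fin D) => g l k • fun i : Fin N => M i l)
  have h0 : (Matrix.of fun i k : Fin N => ∑ l, M i l * g l k).transpose =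
      fun k : Fin N => ∑ l, g l k • fun i : Fin N => M i l := by
    ext k i
    simp [Finset.sum_apply, mul_comm]
  rw [h0]
  refine h.trans (Finset.sum_congr rfl fun f _ => ?_)
  rw [MultilinearMap.map_smul_univ, smul_eq_mul, mul_comm]
  congr 1
  exact Matrix.det_transpose (Matrix.of fun i k : Fin N => M i (f k))

end CoefficientLemmas

/-! ### The Cauchy identity and the spanning property -/

section Cauchy

variable {F : Type*} [Field F] [CharZero F] {N : ℕ}

/-- The determinant of the series `dualPow` of degrees `f i` in the variables with indices `k`. -/
def dualDet (e : ℤ → F) (N : ℕ) (f : Fin N → ℕ) : MvPowerSeries (Fin N) F :=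
  (Matrix.of fun i k : Fin N => inVar k (dualPow (fun l => e ((N : ℤ) - 2 - l)) (f i))).det

/-- The value of a functional on the product of the series `genSeries` in `N` variables. -/
def functionalSeries (a : ℕ → F) (N : ℕ) (L : Sym F →ₗ[F] F) : MvPowerSeries (Fin N) F :=
  fun d => L (∏ k, PowerSeries.coeff (d k) (genSeries a))

theorem coeff_functionalSeries (a : ℕ → F) (L : Sym F →ₗ[F] F) (d : Fin N →₀ ℕ) :
    MvPowerSeries.coeff d (functionalSeries a N L) =
      L (∏ k, PowerSeries.coeff (d k) (genSeries a)) := rfl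

/-- The coefficientwise application of a functional. -/
def mapFunctional (L : Sym F →ₗ[F] F) (G : MvPowerSeries (Fin N) (Sym F)) :
    MvPowerSeries (Fin N) F := fun d => L (MvPowerSeries.coeff d G)

theorem mapFunctional_mul_map (L : Sym F →ₗ[F] F) (G : MvPowerSeries (Fin N) (Sym F))
    (A : MvPowerSeries (Fin N) F) :
    mapFunctional L (G * MvPowerSeries.map (MvPolynomial.C : F →+* Sym F) A) =
      mapFunctional L G * A := by
  classical
  ext d
  change L (MvPowerSeries.coeff d _) = _
  rw [MvPowerSeries.coeff_mul, MvPowerSeries.coeff_mul, map_sum]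
  refine Finset.sum_congr rfl fun x _ => ?_
  rw [MvPowerSeries.coeff_map, mul_comm, ← MvPolynomial.smul_eq_C_mul, map_smul, smul_eq_mul,
    mul_comm]
  rfl

theorem functionalSeries_eq (a : ℕ → F) (L : Sym F →ₗ[F] F) :
    functionalSeries a N L = mapFunctional L (∏ k : Fin N, inVar k (genSeries a)) := by
  ext d
  change _ = L (MvPowerSeries.coeff d _)
  rw [coeff_prod_inVar, coeff_functionalSeries]

/-- The factors G(y_k) are absorbed into the columns of the determinant, whose entries are then
expanded by `genMatrix`. Truncation at D is exact, since `dualPow` of index l has no terms below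
degree l. -/
theorem coeff_functionalSeries_mul (e : ℤ → F) (a : ℕ → F) (L : Sym F →ₗ[F] F)
    (d : Fin N →₀ ℕ) {D : ℕ} (hD : ∀ k, d k < D) :
    MvPowerSeries.coeff d (functionalSeries a N L * dualDet e N fun i => N - 1 - (i : ℕ)) =
      ∑ f : Fin N → Fin D, L (genDet e a N fun k => f k) *
        ∏ k, PowerSeries.coeff (d k) (dualPow (fun l => e ((N : ℤ) - 2 - l)) (f k)) := by
  classical
  have hmap : ∀ l, dualPow (constSeq e ((N : ℤ) - 2)) l =
      PowerSeries.map (MvPolynomial.C : F →+* Sym F) (dualPow (fun l => e ((N : ℤ) - 2 - l)) l) :=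
    fun l => by rw [map_dualPow]; rfl
  have h1 : (∏ k : Fin N, inVar k (genSeries a)) * MvPowerSeries.map
      (MvPolynomial.C : F →+* Sym F) (dualDet e N fun i => N - 1 - (i : ℕ)) =
      (Matrix.of fun i k : Fin N => inVar k (genSeries a * dualPow (constSeq e ((N : ℤ) - 2))
        (N - 1 - (i : ℕ)))).det := by
    simp only [inVar_mul]
    rw [dualDet, RingHom.map_det]
    refine Eq.trans ?_ (Matrix.det_mul_row (fun k : Fin N => inVar k (genSeries a))
      (Matrix.of fun i k : Fin N => inVar k (dualPow (constSeq e ((N : ℤ) - 2))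
        (N - 1 - (i : ℕ))))).symm
    congr 2
    ext1 i k
    simp only [RingHom.mapMatrix_apply, Matrix.map_apply, Matrix.of_apply]
    rw [map_inVar, hmap]
  have h2 := congrArg (MvPowerSeries.coeff d) h1
  rw [coeff_det_inVar] at h2
  have h3 : (Matrix.of fun i k : Fin N => PowerSeries.coeff (d k) (genSeries a *
      dualPow (constSeq e ((N : ℤ) - 2)) (N - 1 - (i : ℕ)))) =
      Matrix.of fun i k : Fin N => ∑ l : Fin D, genMatrix e a ((N : ℤ) - 2) (N - 1 - (i : ℕ)) l *
        MvPolynomial.C (PowerSeries.coeff (d k) (dualPow (fun l => e ((N : ℤ) - 2 - l)) l)) := by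
    ext1 i k
    rw [Matrix.of_apply, Matrix.of_apply, (isExpansion_genMatrix e a _ _).coeff_eq (hD k),
      Finset.sum_range]
    refine Finset.sum_congr rfl fun l _ => ?_
    rw [hmap, PowerSeries.coeff_map]
  rw [h3, det_sum_columns] at h2
  rw [functionalSeries_eq, ← mapFunctional_mul_map]
  refine (congrArg L h2).trans ?_
  rw [map_sum]
  refine Finset.sum_congr rfl fun f _ => ?_
  rw [← map_prod, mul_comm, ← MvPolynomial.smul_eq_C_mul, map_smul, smul_eq_mul, mul_comm]
  rfl

/-- L kills every `genDet` whose columns are not a rearrangement of `stair μ N` and gives the sign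
on the rearrangements; their signed sum is the Leibniz expansion of the determinant. -/
theorem functionalSeries_mul_dualDet (e : ℤ → F) (a : ℕ → F) (N : ℕ) (L : Sym F →ₗ[F] F)
    (μ : YoungDiagram) (h1 : L (multiSchur e a μ) = 1)
    (h0 : ∀ ν, ν ≠ μ → L (multiSchur e a ν) = 0) :
    functionalSeries a N L * (dualDet e N fun i => N - 1 - (i : ℕ)) =
      if length μ ≤ N then dualDet e N (stair μ N) else 0 := by
  classical
  ext d
  have hne : ∀ f : Fin N → ℕ, (¬ (length μ ≤ N ∧ ∃ w : Equiv.Perm (Fin N), f = stair μ N ∘ w)) →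
      L (genDet e a N f) = 0 := by
    intro f hf
    rcases genDet_eq_zero_or e a f with h | ⟨ν, hν, w, hw, h⟩
    · rw [h, map_zero]
    · rw [h, map_zsmul, h0 ν, smul_zero]
      rintro rfl
      exact hf ⟨hν, w, hw⟩
  -- Large enough both for the truncation in degree d and for the entries of `stair μ N` to lie in
  -- `Fin D`.
  set D := (∑ k, d k) + (∑ k, stair μ N k) + 1 with hD
  have hd : ∀ k, d k < D := fun k => by
    have := Finset.single_le_sum (f := fun k => d k) (fun _ _ => Nat.zero_le _)
      (Finset.mem_univ k)
    omega
  have hs : ∀ k, stair μ N k < D := fun k => by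
    have := Finset.single_le_sum (f := fun k => stair μ N k) (fun _ _ => Nat.zero_le _)
      (Finset.mem_univ k)
    omega
  rw [coeff_functionalSeries_mul e a L d hd]
  split_ifs with hμ
  · rw [dualDet, coeff_det_inVar, Matrix.det_apply]
    symm
    refine Fintype.sum_of_injective (fun (w : Equiv.Perm (Fin N)) k => ⟨stair μ N (w k), hs _⟩)
      ?_ _ _ ?_ ?_
    · intro w w' hw
      ext k
      have := congrFun hw k
      rw [(stair_strictAnti μ N).injective (Fin.mk.inj_iff.1 this)]
    · intro f hf
      rw [hne, zero_mul]
      rintro ⟨-, w, hw⟩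
      exact hf ⟨w, funext fun k => Fin.ext (congrFun hw k).symm⟩
    · intro w
      have : (fun k : Fin N => (((⟨stair μ N (w k), hs _⟩ : Fin D)) : ℕ)) = stair μ N ∘ w := rfl
      simp only [this]
      rw [genDet_comp_perm, genDet_stair e a hμ, map_zsmul, h1, Units.smul_def]
      simp only [Matrix.of_apply, zsmul_eq_mul, mul_one]
  · rw [map_zero]
    refine Finset.sum_eq_zero fun f _ => ?_
    rw [hne _ fun h => hμ h.1, zero_mul]

/-- At the staircase monomial the coefficient is a unitriangular determinant. -/
theorem dualDet_staircase_ne_zero (e : ℤ → F) (N : ℕ) :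
    (dualDet e N fun i => N - 1 - (i : ℕ)) ≠ 0 := by
  intro h
  have h1 := congrArg (MvPowerSeries.coeff
    (Finsupp.equivFunOnFinite.symm fun i : Fin N => N - 1 - (i : ℕ))) h
  rw [dualDet, coeff_det_inVar, map_zero, Matrix.det_of_isLowerTriangular] at h1
  · refine one_ne_zero (Eq.trans (Finset.prod_eq_one fun i _ => ?_).symm h1)
    rw [Matrix.of_apply, Finsupp.equivFunOnFinite_symm_apply_apply, coeff_dualPow_self]
  · intro i k hik
    rw [Matrix.of_apply, Finsupp.equivFunOnFinite_symm_apply_apply]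
    refine coeff_dualPow_of_lt _ ?_
    have h2 : (i : ℕ) < k := OrderDual.toDual_lt_toDual.1 hik
    have := k.2
    omega

theorem adjoin_coeff_genSeries (a : ℕ → F) :
    Algebra.adjoin F (Set.range fun n => PowerSeries.coeff n (genSeries a)) = ⊤ := by
  set A := Algebra.adjoin F (Set.range fun n => PowerSeries.coeff n (genSeries a))
  have hmem : ∀ n, PowerSeries.coeff n (genSeries a) ∈ A := fun n =>
    Algebra.subset_adjoin ⟨n, rfl⟩
  have hX : ∀ n : ℕ, PowerSeries.coeff n (genLogDeriv a) ∈ A := by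
    intro n
    induction n using Nat.strong_induction_on with
    | _ n ih =>
      -- Newton's identities: p_{n+1} - a_{n+1} is a polynomial in the coefficients of G.
      have h := congrArg (PowerSeries.coeff n) (derivative_genSeries a)
      rw [PowerSeries.coeff_derivative, PowerSeries.coeff_mul,
        Finset.Nat.sum_antidiagonal_eq_sum_range_succ_mk, Finset.sum_range_succ, Nat.sub_self,
        PowerSeries.coeff_zero_eq_constantCoeff_apply, constantCoeff_genSeries, mul_one] at h
      rw [← sub_eq_iff_eq_add'.2 h]
      refine A.sub_mem (A.mul_mem (hmem _) (A.add_mem (natCast_mem A n) A.one_mem)) ?_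
      exact A.sum_mem fun i hi => A.mul_mem (ih i (Finset.mem_range.1 hi)) (hmem _)
  rw [eq_top_iff, ← MvPolynomial.adjoin_range_X]
  refine Algebra.adjoin_le ?_
  rintro _ ⟨n, rfl⟩
  have h := A.add_mem (hX n.natPred) (A.algebraMap_mem (a (n.natPred + 1)))
  rwa [genLogDeriv, PowerSeries.coeff_mk, MvPolynomial.algebraMap_eq, sub_add_cancel,
    PNat.succPNat_natPred] at h

/-- By the Cauchy expansion `functionalSeries` vanishes for every N. Its coefficients are the values
of L on all products of coefficients of G, and these products span `Sym F`. -/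
theorem eq_zero_of_multiSchur_eq_zero (e : ℤ → F) (a : ℕ → F) (L : Sym F →ₗ[F] F)
    (h : ∀ μ, L (multiSchur e a μ) = 0) : L = 0 := by
  have h1 : ∀ N, functionalSeries a N L = 0 := by
    intro N
    refine (mul_eq_zero.1 (?_ : _ * (dualDet e N fun i => N - 1 - (i : ℕ)) = 0)).resolve_right
      (dualDet_staircase_ne_zero e N)
    ext d
    rw [coeff_functionalSeries_mul e a L d (D := (∑ k, d k) + 1), map_zero]
    · refine Finset.sum_eq_zero fun f _ => ?_
      rcases genDet_eq_zero_or e a (fun k => (f k : ℕ)) with h2 | ⟨ν, hν, w, hw, h2⟩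
      · rw [h2, map_zero, zero_mul]
      · rw [h2, map_zsmul, h, smul_zero, zero_mul]
    · intro k
      exact Nat.lt_succ_of_le (Finset.single_le_sum (f := fun k => d k) (fun _ _ => Nat.zero_le _)
        (Finset.mem_univ k))
  have h2 : ∀ x ∈ Submonoid.closure (Set.range fun n => PowerSeries.coeff n (genSeries a)),
      L x = 0 := by
    intro x hx
    obtain ⟨l, hl, rfl⟩ := Submonoid.exists_list_of_mem_closure hx
    choose! d hd using hl
    have h3 := congrArg (MvPowerSeries.coeff (Finsupp.equivFunOnFinite.symm
      fun k : Fin l.length => d (l.get k))) (h1 l.length)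
    rw [coeff_functionalSeries, map_zero] at h3
    rw [← h3]
    congr 1
    rw [← List.prod_ofFn]
    congr 1
    refine List.ext_getElem (by simp) fun i h4 h5 => ?_
    rw [List.getElem_ofFn, Finsupp.equivFunOnFinite_symm_apply_apply]
    exact (hd _ (List.getElem_mem _)).symm
  have h3 : (⊤ : Submodule F (Sym F)) ≤ LinearMap.ker L := by
    rw [← Algebra.top_toSubmodule, ← adjoin_coeff_genSeries a, Algebra.adjoin_eq_span,
      Submodule.span_le]
    exact h2
  exact LinearMap.ext fun x => h3 trivial

theorem span_multiSchur (e : ℤ → F) (a : ℕ → F) :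
    Submodule.span F (Set.range (multiSchur e a)) = ⊤ := by
  by_contra h
  obtain ⟨L, hL0, hL⟩ := Submodule.exists_le_ker_of_lt_top _ (lt_top_iff_ne_top.2 h)
  exact hL0 (eq_zero_of_multiSchur_eq_zero e a L fun μ =>
    hL (Submodule.subset_span ⟨μ, rfl⟩))

end Cauchy
end InterpMac
end

noncomputable section
set_option linter.unusedSectionVars false
namespace InterpMac

/-! ### The reproducing kernel of the scalar product at t = q -/

section Reproducing

variable {F : Type*} [Field F]

theorem pairing_eq_sum (q t : F) (f : Sym F) (g : SymHat F) {s : Finset (ℕ+ →₀ ℕ)}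
    (hs : f.support ⊆ s) : pairing q t f g =
      ∑ m ∈ s, f.coeff m * MvPowerSeries.coeff m g * powerSumNorm q t m :=
  Finset.sum_subset hs fun m _ hm => by
    rw [MvPolynomial.notMem_support_iff.1 hm, zero_mul, zero_mul]

/-- The Macdonald pairing as a linear functional. -/
def pairingMap (q t : F) (g : SymHat F) : Sym F →ₗ[F] F where
  toFun f := pairing q t f g
  map_add' f f' := by
    classical
    rw [pairing_eq_sum q t (f + f') g MvPolynomial.support_add,
      pairing_eq_sum q t f g Finset.subset_union_left,
      pairing_eq_sum q t f' g Finset.subset_union_right, ← Finset.sum_add_distrib]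
    exact Finset.sum_congr rfl fun m _ => by rw [MvPolynomial.coeff_add]; ring
  map_smul' c f := by
    rw [pairing_eq_sum q t (c • f) g MvPolynomial.support_smul, pairing, RingHom.id_apply,
      smul_eq_mul, Finset.mul_sum]
    exact Finset.sum_congr rfl fun m _ => by rw [MvPolynomial.coeff_smul, smul_eq_mul]; ring

theorem pairingMap_apply (q t : F) (g : SymHat F) (f : Sym F) :
    pairingMap q t g f = pairing q t f g := rfl

theorem powerSumNorm_zero (q t : F) : powerSumNorm q t 0 = 1 := by simp [powerSumNorm]

theorem powerSumNorm_add_single {q : F} (hq : ∀ n : ℕ, 1 ≤ n → q ^ n ≠ 1) (m : ℕ+ →₀ ℕ) (n : ℕ+) :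
    powerSumNorm q q (m + Finsupp.single n 1) =
      powerSumNorm q q m * (((n : ℕ) : F) * ((m n : F) + 1)) := by
  classical
  have h1 : ∀ n : ℕ+, (1 - q ^ (n : ℕ)) / (1 - q ^ (n : ℕ)) = 1 := fun n =>
    div_self (sub_ne_zero.2 (hq n n.2).symm)
  set s := (m + Finsupp.single n 1).support ∪ m.support ∪ {n}
  have hs : ∀ m' : ℕ+ →₀ ℕ, m'.support ⊆ s → powerSumNorm q q m' =
      ∏ n ∈ s, ((n : ℕ) : F) ^ m' n * ((m' n).factorial : F) := by
    intro m' hm'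
    rw [powerSumNorm, Finsupp.prod_of_support_subset _ hm' _ (by simp)]
    simp [h1]
  have hn : n ∈ s := by simp [s]
  rw [hs _ (by intro x hx; simp only [s, Finset.mem_union]; exact Or.inl (Or.inl hx)),
    hs m (by intro x hx; simp only [s, Finset.mem_union]; exact Or.inl (Or.inr hx)),
    ← Finset.mul_prod_erase s _ hn, ← Finset.mul_prod_erase s _ hn]
  rw [Finset.prod_congr rfl fun k hk => by
    rw [Finsupp.add_apply, Finsupp.single_eq_of_ne (Finset.ne_of_mem_erase hk), add_zero]]
  simp only [Finsupp.add_apply, Finsupp.single_eq_same, Nat.factorial_succ, pow_succ]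
  push_cast
  ring

variable [CharZero F]

theorem powerSumNorm_ne_zero {q : F} (hq : ∀ n : ℕ, 1 ≤ n → q ^ n ≠ 1) (m : ℕ+ →₀ ℕ) :
    powerSumNorm q q m ≠ 0 := by
  rw [powerSumNorm, Finsupp.prod]
  refine Finset.prod_ne_zero_iff.2 fun n _ => ?_
  rw [div_self (sub_ne_zero.2 (hq n n.2).symm), one_pow, mul_one]
  exact mul_ne_zero (pow_ne_zero _ (Nat.cast_ne_zero.2 n.ne_zero))
    (Nat.cast_ne_zero.2 (Nat.factorial_ne_zero _))

/-- Monomials in the power sums are orthogonal with nonzero norms, and the completion allows their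
coefficients to be prescribed freely. -/
theorem exists_pairingMap_eq {q : F} (hq : ∀ n : ℕ, 1 ≤ n → q ^ n ≠ 1) (L : Sym F →ₗ[F] F) :
    ∃ g : SymHat F, pairingMap q q g = L := by
  set g : SymHat F := fun m => L (MvPolynomial.monomial m 1) / powerSumNorm q q m with hg
  have hcoeff : ∀ m, MvPowerSeries.coeff m g =
      L (MvPolynomial.monomial m 1) / powerSumNorm q q m := fun m => rfl
  refine ⟨g, LinearMap.ext fun f => ?_⟩
  rw [pairingMap_apply, pairing]
  conv_rhs => rw [f.as_sum, map_sum]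
  refine Finset.sum_congr rfl fun m _ => ?_
  rw [hcoeff, mul_assoc, div_mul_cancel₀ _ (powerSumNorm_ne_zero hq m), ← smul_eq_mul, ← map_smul,
    MvPolynomial.smul_monomial, smul_eq_mul, mul_one]

/-- On G, differentiation in p_n is multiplication by X^n / n: both series solve y' = (G'/G) y +
X^(n-1) G with zero constant term. -/
theorem pderiv_coeff_genSeries (n : ℕ+) (k : ℕ) (a : ℕ → F) :
    MvPolynomial.pderiv n (PowerSeries.coeff k (genSeries a)) =
      if (n : ℕ) ≤ k then MvPolynomial.C (1 / ((n : ℕ) : F)) *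
        PowerSeries.coeff (k - n) (genSeries a) else 0 := by
  set H := genSeries a
  set Z : PowerSeries (Sym F) := PowerSeries.mk fun k =>
    MvPolynomial.pderiv n (PowerSeries.coeff k H) with hZ
  have hP : ∀ k, MvPolynomial.pderiv n (PowerSeries.coeff k (genLogDeriv a)) =
      PowerSeries.coeff k (PowerSeries.X ^ ((n : ℕ) - 1) : PowerSeries (Sym F)) := by
    intro k
    rw [genLogDeriv, PowerSeries.coeff_mk, map_sub, MvPolynomial.pderiv_C, sub_zero,
      PowerSeries.coeff_X_pow]
    have hn : 1 ≤ (n : ℕ) := n.2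
    split_ifs with h
    · have : k.succPNat = n := PNat.eq (by rw [Nat.succPNat_coe, h]; omega)
      rw [this, MvPolynomial.pderiv_X_self]
    · refine MvPolynomial.pderiv_X_of_ne fun h2 => h ?_
      rw [← h2, Nat.succPNat_coe]; omega
  have h1 : PowerSeries.derivative _ Z = genLogDeriv a * Z + PowerSeries.X ^ ((n : ℕ) - 1) * H := by
    ext1 k
    have h := congrArg (fun A => MvPolynomial.pderiv n (PowerSeries.coeff k A))
      (derivative_genSeries a)
    simp only [PowerSeries.coeff_derivative, PowerSeries.coeff_mul, map_sum,
      MvPolynomial.pderiv_mul, hP] at h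
    rw [PowerSeries.coeff_derivative, hZ, PowerSeries.coeff_mk, map_add, PowerSeries.coeff_mul,
      PowerSeries.coeff_mul]
    simp only [PowerSeries.coeff_mk]
    rw [Finset.sum_add_distrib, add_comm (Finset.sum _ _)] at h
    rw [← h]
    have h3 : MvPolynomial.pderiv n ((k : Sym F) + 1) = 0 := by simp
    rw [h3, mul_zero, add_zero]
  have h2 : PowerSeries.derivative _ (PowerSeries.C (MvPolynomial.C (1 / ((n : ℕ) : F))) *
      (PowerSeries.X ^ (n : ℕ) * H)) = genLogDeriv a * (PowerSeries.C (MvPolynomial.C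
        (1 / ((n : ℕ) : F))) * (PowerSeries.X ^ (n : ℕ) * H)) +
        PowerSeries.X ^ ((n : ℕ) - 1) * H := by
    rw [Derivation.leibniz, Derivation.leibniz, derivative_genSeries, PowerSeries.derivative_C,
      PowerSeries.derivative_pow, PowerSeries.derivative_X]
    simp only [smul_eq_mul]
    have h3 : PowerSeries.C (MvPolynomial.C (1 / ((n : ℕ) : F))) *
        (((n : ℕ) : PowerSeries (Sym F))) = 1 := by
      rw [← map_natCast (PowerSeries.C : Sym F →+* _), ← map_natCast (MvPolynomial.C : F →+* Sym F),
        ← map_mul, ← map_mul, one_div_mul_cancel (Nat.cast_ne_zero.2 n.ne_zero), map_one, map_one]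
    linear_combination (PowerSeries.X ^ ((n : ℕ) - 1) * H) * h3
  have h3 := eq_of_derivative_eq h1 h2 (by
    rw [map_mul, map_mul, map_pow, PowerSeries.constantCoeff_X, zero_pow n.ne_zero, zero_mul,
      mul_zero, ← PowerSeries.coeff_zero_eq_constantCoeff_apply, hZ, PowerSeries.coeff_mk,
      PowerSeries.coeff_zero_eq_constantCoeff_apply, constantCoeff_genSeries,
      MvPolynomial.pderiv_one])
  have h4 := congrArg (PowerSeries.coeff k) h3
  rw [hZ, PowerSeries.coeff_mk, PowerSeries.coeff_C_mul, PowerSeries.coeff_X_pow_mul'] at h4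
  rw [h4, mul_ite, mul_zero]

theorem pderiv_prod {ι σ : Type*} [DecidableEq ι] (s : Finset ι) (f : ι → MvPolynomial σ F)
    (n : σ) : MvPolynomial.pderiv n (∏ k ∈ s, f k) =
      ∑ k ∈ s, (∏ j ∈ s.erase k, f j) * MvPolynomial.pderiv n (f k) := by
  induction s using Finset.induction_on with
  | empty => simp
  | insert i s hi ih =>
    rw [Finset.prod_insert hi, MvPolynomial.pderiv_mul, ih, Finset.sum_insert hi,
      Finset.erase_insert hi, mul_comm (∏ k ∈ s, f k), Finset.mul_sum]
    congr 1
    refine Finset.sum_congr rfl fun k hk => ?_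
    have hik : k ≠ i := fun h => hi (h ▸ hk)
    rw [Finset.erase_insert_of_ne hik.symm, Finset.prod_insert
      (fun h => hi (Finset.mem_of_mem_erase h)), mul_assoc]

theorem constantCoeff_coeff_genSeries (k : ℕ) :
    MvPolynomial.constantCoeff (PowerSeries.coeff k (genSeries (0 : ℕ → F))) =
      if k = 0 then 1 else 0 := by
  have h : PowerSeries.map (MvPolynomial.constantCoeff : Sym F →+* F) (genSeries 0) = 1 := by
    refine eq_of_derivative_eq (P := 0) (Q := 0) ?_ ?_ ?_
    · rw [derivative_map, derivative_genSeries, map_mul]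
      have : PowerSeries.map (MvPolynomial.constantCoeff : Sym F →+* F) (genLogDeriv 0) = 0 := by
        ext n; simp [genLogDeriv]
      rw [this]; simp
    · simp
    · rw [← PowerSeries.coeff_zero_eq_constantCoeff_apply, PowerSeries.coeff_map,
        PowerSeries.coeff_zero_eq_constantCoeff_apply, constantCoeff_genSeries]
      simp
  rw [← PowerSeries.coeff_map, h, PowerSeries.coeff_one]

theorem coeff_psumSeries_mul {N : ℕ} (n : ℕ+) (G : MvPowerSeries (Fin N) F) (d : Fin N →₀ ℕ) :
    MvPowerSeries.coeff d (psumSeries F N n * G) =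
      ∑ k, if (n : ℕ) ≤ d k then MvPowerSeries.coeff (d - Finsupp.single k (n : ℕ)) G else 0 := by
  classical
  have h : psumSeries F N n = ∑ k, (MvPowerSeries.X k : MvPowerSeries (Fin N) F) ^ (n : ℕ) := by
    rw [psumSeries, MvPolynomial.psum, ← MvPolynomial.coeToMvPowerSeries.ringHom_apply, map_sum]
    simp
  rw [h, Finset.sum_mul, map_sum]
  refine Finset.sum_congr rfl fun k _ => ?_
  rw [MvPowerSeries.X_pow_eq, MvPowerSeries.coeff_monomial_mul, one_mul]
  simp only [Finsupp.single_le_iff]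

theorem pderiv_prod_genSeries {N : ℕ} (n : ℕ+) (d : Fin N →₀ ℕ) (a : ℕ → F) :
    MvPolynomial.C ((n : ℕ) : F) *
      MvPolynomial.pderiv n (∏ k, PowerSeries.coeff (d k) (genSeries a)) =
      ∑ k, if (n : ℕ) ≤ d k then
        ∏ j, PowerSeries.coeff ((d - Finsupp.single k (n : ℕ)) j) (genSeries a) else 0 := by
  classical
  rw [pderiv_prod, Finset.mul_sum]
  refine Finset.sum_congr rfl fun k _ => ?_
  rw [pderiv_coeff_genSeries]
  split_ifs with h
  · rw [← Finset.mul_prod_erase _ _ (Finset.mem_univ k), Finsupp.tsub_apply,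
      Finsupp.single_eq_same]
    have h1 : (MvPolynomial.C ((n : ℕ) : F) : Sym F) * MvPolynomial.C (1 / ((n : ℕ) : F)) = 1 := by
      rw [← map_mul, mul_one_div_cancel (Nat.cast_ne_zero.2 n.ne_zero), map_one]
    have h2 : ∏ j ∈ Finset.univ.erase k, PowerSeries.coeff ((d - Finsupp.single k (n : ℕ)) j)
        (genSeries a) = ∏ j ∈ Finset.univ.erase k, PowerSeries.coeff (d j) (genSeries a) :=
      Finset.prod_congr rfl fun j hj => by
        rw [Finsupp.tsub_apply, Finsupp.single_eq_of_ne (Finset.ne_of_mem_erase hj), tsub_zero]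
    rw [h2]
    linear_combination ((∏ j ∈ Finset.univ.erase k, PowerSeries.coeff (d j) (genSeries a)) *
      PowerSeries.coeff (d k - n) (genSeries a)) * h1
  · rw [mul_zero, mul_zero]

/-- The kernel expansion ∏ G(y_k) = Σ_m p_m(x) p_m(y) / norm(m). It follows by induction on the
number of power sum factors, since n ∂/∂p_n acts on the kernel as multiplication by p_n(y). -/
theorem coeff_prod_genSeries {q : F} (hq : ∀ n : ℕ, 1 ≤ n → q ^ n ≠ 1) {N : ℕ}
    (m : ℕ+ →₀ ℕ) (d : Fin N →₀ ℕ) :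
    MvPolynomial.coeff m (∏ k, PowerSeries.coeff (d k) (genSeries (0 : ℕ → F))) *
      powerSumNorm q q m = MvPowerSeries.coeff d (m.prod fun n j => psumSeries F N n ^ j) := by
  classical
  induction hr : m.degree generalizing m d with
  | zero =>
    obtain rfl := (Finsupp.degree_eq_zero_iff m).1 hr
    rw [powerSumNorm_zero, mul_one, Finsupp.prod_zero_index, MvPowerSeries.coeff_one]
    change MvPolynomial.constantCoeff _ = _
    rw [map_prod]
    simp only [constantCoeff_coeff_genSeries]
    rw [Finset.prod_ite_zero]
    simp [Finsupp.ext_iff]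
  | succ r ih =>
    obtain ⟨n, hn⟩ : ∃ n, m n ≠ 0 := by
      by_contra! h
      rw [show m = 0 from Finsupp.ext h] at hr
      simp at hr
    obtain ⟨m', rfl⟩ : ∃ m', m = m' + Finsupp.single n 1 :=
      ⟨m - Finsupp.single n 1, (tsub_add_cancel_of_le (Finsupp.single_le_iff.2
        (Nat.one_le_iff_ne_zero.2 hn))).symm⟩
    have hr' : m'.degree = r := by
      simpa using hr
    rw [Finsupp.prod_add_index' (h := fun n j => psumSeries F N n ^ j) (by simp)
        (fun _ _ _ => pow_add _ _ _),
      Finsupp.prod_single_index (h := fun n j => psumSeries F N n ^ j) (pow_zero _), pow_one,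
      mul_comm (Finsupp.prod _ _),
      coeff_psumSeries_mul, powerSumNorm_add_single hq]
    have h1 := congrArg (fun p => MvPolynomial.coeff m' p * powerSumNorm q q m')
      (pderiv_prod_genSeries n d (0 : ℕ → F))
    simp only [MvPolynomial.coeff_C_mul, MvPolynomial.coeff_pderiv, MvPolynomial.coeff_sum,
      Finset.sum_mul] at h1
    refine Eq.trans ?_ (h1.trans (Finset.sum_congr rfl fun k _ => ?_))
    · ring
    · split_ifs with h
      · exact ih m' _ hr'
      · rw [MvPolynomial.coeff_zero, zero_mul]

theorem restrictHat_eq {q : F} (hq : ∀ n : ℕ, 1 ≤ n → q ^ n ≠ 1) (N : ℕ) (h : SymHat F) :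
    restrictHat F N h = functionalSeries 0 N (pairingMap q q h) := by
  ext d
  rw [coeff_functionalSeries, pairingMap_apply, restrictHat,
    MvPowerSeries.coeff_subst (hasSubst_psumSeries F N), pairing]
  -- By the kernel expansion, a power sum monomial missing from the product contributes nothing to
  -- the substitution.
  rw [finsum_eq_sum_of_support_subset]
  · refine Finset.sum_congr rfl fun m _ => ?_
    rw [smul_eq_mul, ← coeff_prod_genSeries hq]; ring
  · intro m hm
    rw [Finset.mem_coe, MvPolynomial.mem_support_iff]
    intro h0
    refine hm ?_
    simp only
    rw [← coeff_prod_genSeries hq, h0, zero_mul, smul_zero]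

/-- The shift `a_n = 1 / (1 - q ^ n)`. -/
def qShift (q : F) (n : ℕ) : F := 1 / (1 - q ^ n)

theorem derivative_qPochhammerInf (q : F) : PowerSeries.derivative F (qPochhammerInf q) =
    (PowerSeries.mk fun n => -qShift q (n + 1)) * qPochhammerInf q := by
  have h := derivative_expSeries (R := F) (f := PowerSeries.mk fun m : ℕ =>
    if m = 0 then (0 : F) else -(1 / ((m : F) * (1 - q ^ m))))
    (by rw [← PowerSeries.coeff_zero_eq_constantCoeff_apply]; simp)
  refine h.trans ?_
  congr 1
  ext n
  have hn : (n : F) + 1 ≠ 0 := Nat.cast_add_one_ne_zero n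
  rw [PowerSeries.coeff_derivative, PowerSeries.coeff_mk, PowerSeries.coeff_mk,
    if_neg n.succ_ne_zero, qShift, Nat.cast_add_one, one_div, one_div, mul_inv]
  field_simp

theorem constantCoeff_qPochhammerInf (q : F) :
    PowerSeries.constantCoeff (qPochhammerInf q) = 1 :=
  constantCoeff_expSeries (by rw [← PowerSeries.coeff_zero_eq_constantCoeff_apply]; simp)

/-- The constants a_n = 1/(1 - q^n) split off from the exponential as exactly (X; q)_∞. -/
theorem genSeries_qShift (q : F) : genSeries (qShift q) =
    genSeries 0 * PowerSeries.map (MvPolynomial.C : F →+* Sym F) (qPochhammerInf q) := by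
  refine eq_of_derivative_eq (P := genLogDeriv (qShift q)) (Q := 0) ?_ ?_ ?_
  · rw [derivative_genSeries, add_zero]
  · rw [Derivation.leibniz, derivative_map, derivative_qPochhammerInf, derivative_genSeries,
      map_mul, add_zero, smul_eq_mul, smul_eq_mul]
    have h : genLogDeriv (qShift q) = genLogDeriv 0 + PowerSeries.map
        (MvPolynomial.C : F →+* Sym F) (PowerSeries.mk fun n => -qShift q (n + 1)) := by
      ext1 n
      simp [genLogDeriv, sub_eq_add_neg]
    rw [h]; ring
  · rw [map_mul, constantCoeff_genSeries, constantCoeff_genSeries, one_mul,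
      ← PowerSeries.coeff_zero_eq_constantCoeff_apply, PowerSeries.coeff_map,
      PowerSeries.coeff_zero_eq_constantCoeff_apply, constantCoeff_qPochhammerInf, map_one]

theorem restrictHat_mul_qPochhammerInf {q : F} (hq : ∀ n : ℕ, 1 ≤ n → q ^ n ≠ 1) (N : ℕ)
    (h : SymHat F) :
    restrictHat F N h * ∏ j : Fin N, (qPochhammerInf q).subst
      (MvPowerSeries.X j : MvPowerSeries (Fin N) F) =
      functionalSeries (qShift q) N (pairingMap q q h) := by
  rw [restrictHat_eq hq, functionalSeries_eq, functionalSeries_eq]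
  refine (mapFunctional_mul_map _ _ _).symm.trans ?_
  rw [map_prod, ← Finset.prod_mul_distrib, genSeries_qShift]
  congr 1
  refine Finset.prod_congr rfl fun k _ => ?_
  rw [inVar_mul, ← map_inVar]
  rfl

end Reproducing
end InterpMac
end

noncomputable section
set_option linter.unusedSectionVars false
namespace InterpMac

/-! ### Leading homogeneous components -/

section TopDegree

variable {σ F : Type*} [Field F]

/-- All monomials of `p` have degree less than `n`. -/
def DegreeLT (n : ℕ) (p : MvPolynomial σ F) : Prop := ∀ d : σ →₀ ℕ, n ≤ d.degree → p.coeff d = 0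

theorem DegreeLT.add {n : ℕ} {p p' : MvPolynomial σ F} (h : DegreeLT n p) (h' : DegreeLT n p') :
    DegreeLT n (p + p') := fun d hd => by
  rw [MvPolynomial.coeff_add, h d hd, h' d hd, add_zero]

theorem DegreeLT.mono {n m : ℕ} (hnm : n ≤ m) {p : MvPolynomial σ F} (h : DegreeLT n p) :
    DegreeLT m p := fun d hd => h d (hnm.trans hd)

theorem DegreeLT.mul {n m : ℕ} {p p' : MvPolynomial σ F} (h : DegreeLT n p)
    (h' : DegreeLT (m + 1) p') : DegreeLT (n + m) (p * p') := by
  classical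
  intro d hd
  rw [MvPolynomial.coeff_mul]
  refine Finset.sum_eq_zero fun x hx => ?_
  have hx' := Finset.HasAntidiagonal.mem_antidiagonal.1 hx
  rw [← hx', map_add] at hd
  by_cases h1 : n ≤ x.1.degree
  · rw [h _ h1, zero_mul]
  · rw [h' _ (by omega), mul_zero]

theorem degreeLT_of_isHomogeneous {n : ℕ} {p : MvPolynomial σ F} (h : p.IsHomogeneous n) :
    DegreeLT (n + 1) p := fun _ hd => h.coeff_eq_zero (by omega)

theorem exists_degree_eq_totalDegree {p : MvPolynomial σ F} (hp : p ≠ 0) :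
    ∃ d ∈ p.support, d.degree = p.totalDegree := by
  obtain ⟨d, hd, h⟩ := Finset.exists_mem_eq_sup p.support (MvPolynomial.support_nonempty.2 hp)
    (fun d => d.sum fun _ e => e)
  exact ⟨d, hd, h.symm⟩

theorem DegreeLT.totalDegree_lt {n : ℕ} {p : MvPolynomial σ F} (h : DegreeLT n p) (hp : p ≠ 0) :
    p.totalDegree < n := by
  obtain ⟨d, hd, hdeg⟩ := exists_degree_eq_totalDegree hp
  by_contra hn
  exact MvPolynomial.mem_support_iff.1 hd (h d (by omega))

theorem degreeLT_of_totalDegree_lt {n : ℕ} {p : MvPolynomial σ F} (h : p.totalDegree < n) :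
    DegreeLT n p := fun d hd => by
  by_contra hc
  have := MvPolynomial.le_totalDegree (MvPolynomial.mem_support_iff.2 hc)
  rw [Finsupp.degree_apply] at hd
  exact absurd (h.trans_le hd) (not_lt.2 this)

/-- `t` is homogeneous of degree `n` and `p = t` up to terms of degree less than `n`. -/
def HasTop (n : ℕ) (p t : MvPolynomial σ F) : Prop := t.IsHomogeneous n ∧ DegreeLT n (p - t)

theorem HasTop.degreeLT {n : ℕ} {p t : MvPolynomial σ F} (h : HasTop n p t) :
    DegreeLT (n + 1) p := by
  have := (h.2.mono n.le_succ).add (degreeLT_of_isHomogeneous h.1)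
  rwa [sub_add_cancel] at this

theorem HasTop.mul {n m : ℕ} {p t p' t' : MvPolynomial σ F} (h : HasTop n p t)
    (h' : HasTop m p' t') : HasTop (n + m) (p * p') (t * t') := by
  refine ⟨h.1.mul h'.1, ?_⟩
  have h1 := h.2.mul h'.degreeLT
  have h2 := h'.2.mul (degreeLT_of_isHomogeneous h.1)
  rw [add_comm m n] at h2
  have h3 := h1.add h2
  rwa [show (p - t) * p' + (p' - t') * t = p * p' - t * t' by ring] at h3

theorem hasTop_one : HasTop 0 (1 : MvPolynomial σ F) 1 :=
  ⟨MvPolynomial.isHomogeneous_one _ _, fun d _ => by simp⟩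

theorem HasTop.prod {ι : Type*} (s : Finset ι) {n : ι → ℕ} {p t : ι → MvPolynomial σ F}
    (h : ∀ i, HasTop (n i) (p i) (t i)) :
    HasTop (∑ i ∈ s, n i) (∏ i ∈ s, p i) (∏ i ∈ s, t i) := by
  classical
  induction s using Finset.induction_on with
  | empty => simpa using hasTop_one
  | insert i s hi ih =>
    rw [Finset.prod_insert hi, Finset.prod_insert hi, Finset.sum_insert hi]
    exact (h i).mul ih

theorem HasTop.sum {ι : Type*} (s : Finset ι) {n : ℕ} {p t : ι → MvPolynomial σ F}
    (h : ∀ i, HasTop n (p i) (t i)) : HasTop n (∑ i ∈ s, p i) (∑ i ∈ s, t i) := by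
  refine ⟨MvPolynomial.IsHomogeneous.sum _ _ _ fun i _ => (h i).1, fun d hd => ?_⟩
  rw [← Finset.sum_sub_distrib, MvPolynomial.coeff_sum]
  exact Finset.sum_eq_zero fun i _ => (h i).2 d hd

theorem HasTop.zsmul {n : ℕ} {p t : MvPolynomial σ F} (h : HasTop n p t) (z : ℤ) :
    HasTop n (z • p) (z • t) := by
  refine ⟨(MvPolynomial.homogeneousSubmodule σ F n).toAddSubgroup.zsmul_mem h.1 z,
    fun d hd => ?_⟩
  rw [← smul_sub, MvPolynomial.coeff_smul, h.2 d hd, smul_zero]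

theorem hasTop_X_sub_C (i : σ) (c : F) :
    HasTop 1 (MvPolynomial.X i - MvPolynomial.C c) (MvPolynomial.X i) := by
  classical
  refine ⟨MvPolynomial.isHomogeneous_X _ _, fun d hd => ?_⟩
  rw [sub_sub_cancel_left, MvPolynomial.coeff_neg, MvPolynomial.coeff_C, if_neg, neg_zero]
  rintro rfl
  simp at hd

theorem isHomogeneous_of_mul {m n : ℕ} {V p : MvPolynomial σ F} (hV : V.IsHomogeneous m)
    (hV0 : V ≠ 0) (h : (V * p).IsHomogeneous (m + n)) : p.IsHomogeneous n := by
  classical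
  let _ : GradedAlgebra (MvPolynomial.homogeneousSubmodule σ F) := MvPolynomial.gradedAlgebra
  have h1 : ∀ k, k ≠ n → MvPolynomial.homogeneousComponent k p = 0 := by
    intro k hk
    have h2 := DirectSum.coe_decompose_mul_add_of_left_mem
      (MvPolynomial.homogeneousSubmodule σ F) (i := m) (j := k) (b := p) hV
    have h3 : ∀ (x : MvPolynomial σ F) (j : ℕ), ((DirectSum.decompose
        (MvPolynomial.homogeneousSubmodule σ F) x j : _) : MvPolynomial σ F) =
        MvPolynomial.homogeneousComponent j x :=
      MvPolynomial.decomposition.decompose'_apply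
    rw [h3, h3, MvPolynomial.homogeneousComponent_of_mem h, if_neg (by omega)] at h2
    exact (mul_eq_zero.1 h2.symm).resolve_left hV0
  intro d hd
  by_contra hne
  apply hd
  have := MvPolynomial.coeff_homogeneousComponent d.degree p d
  rw [if_pos rfl, h1 _ (by rwa [Finsupp.degree_eq_weight_one]), MvPolynomial.coeff_zero] at this
  exact this.symm

/-- Degrees add in a domain, so a homogeneous nonzero factor can be cancelled. This transfers
leading terms from alternants to their quotients by the Vandermonde determinant. -/
theorem HasTop.of_mul {m n : ℕ} {V p t : MvPolynomial σ F} (hV : V.IsHomogeneous m)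
    (hV0 : V ≠ 0) (h : HasTop (m + n) (V * p) (V * t)) : HasTop n p t := by
  refine ⟨isHomogeneous_of_mul hV hV0 h.1, ?_⟩
  by_cases h0 : p - t = 0
  · rw [h0]; intro d _; rfl
  · have h1 := h.2
    rw [← mul_sub] at h1
    have h2 := h1.totalDegree_lt (mul_ne_zero hV0 h0)
    rw [MvPolynomial.totalDegree_mul_of_isDomain hV0 h0, hV.totalDegree hV0] at h2
    exact degreeLT_of_totalDegree_lt (by omega)

theorem HasTop.homogeneousComponent_eq {n : ℕ} {p t : MvPolynomial σ F} (h : HasTop n p t) :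
    MvPolynomial.homogeneousComponent n p = t := by
  classical
  ext d
  rw [MvPolynomial.coeff_homogeneousComponent]
  split_ifs with hd
  · have := h.2 d hd.ge
    rwa [MvPolynomial.coeff_sub, sub_eq_zero] at this
  · exact (h.1.coeff_eq_zero hd).symm

theorem HasTop.totalDegree_eq {n : ℕ} {p t : MvPolynomial σ F} (h : HasTop n p t) (ht : t ≠ 0) :
    p.totalDegree = n := by
  refine le_antisymm ?_ (le_of_not_gt fun hlt => ?_)
  · by_cases hp : p = 0
    · simp [hp]
    · exact Nat.lt_succ_iff.1 (h.degreeLT.totalDegree_lt hp)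
  · rw [← h.homogeneousComponent_eq, MvPolynomial.homogeneousComponent_eq_zero _ _ hlt] at ht
    exact ht rfl

end TopDegree

/-! ### Factorial Schur polynomials and their leading terms -/

section FallingMatrix

variable {F : Type*} [Field F] [CharZero F] {N : ℕ}

/-- The Vandermonde determinant in `N` variables, with decreasing exponents. -/
def vander (F : Type*) [Field F] (N : ℕ) : MvPolynomial (Fin N) F :=
  ((Equiv.Perm.sign (Fin.revPerm : Equiv.Perm (Fin N)) : ℤˣ) : ℤ) •
    (Matrix.vandermonde (MvPolynomial.X : Fin N → MvPolynomial (Fin N) F)).det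

/-- The columns are monic polynomials of degrees N-1, …, 0, so the determinant is a Vandermonde
determinant with reversed columns, whatever e is. -/
theorem det_fallingMatrix_staircase (e : ℤ → F) (N : ℕ) :
    (fallingMatrix e N fun k => N - 1 - (k : ℕ)).det = vander F N := by
  have h := Matrix.det_eval_matrixOfPolynomials_eq_det_vandermonde
    (MvPolynomial.X : Fin N → MvPolynomial (Fin N) F)
    (fun j : Fin N => ∏ k ∈ Finset.range j,
      (Polynomial.X - Polynomial.C (MvPolynomial.C (e ((N : ℤ) - 1 - k)))))
    (fun j => by
      rw [Polynomial.natDegree_prod_of_monic _ _ fun k _ => Polynomial.monic_X_sub_C _]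
      simp)
    (fun j => Polynomial.monic_prod_of_monic _ _ fun k _ => Polynomial.monic_X_sub_C _)
  rw [vander, h, zsmul_eq_mul, ← Matrix.det_permute']
  congr 1
  ext1 i k
  rw [Matrix.submatrix_apply, Matrix.of_apply, Polynomial.eval_prod, fallingMatrix,
    Matrix.of_apply, fallingPow, Fin.revPerm_apply, Fin.val_rev]
  rw [show N - 1 - (k : ℕ) = N - (k + 1) by omega]
  simp

theorem vander_ne_zero : vander F N ≠ 0 := by
  rw [vander, zsmul_eq_mul]
  refine mul_ne_zero ?_ (Matrix.det_vandermonde_ne_zero_iff.2 (MvPolynomial.X_injective))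
  exact Int.cast_ne_zero.2 (Units.ne_zero _)

theorem eval_vander_ne_zero_iff (x : Fin N → F) :
    MvPolynomial.eval x (vander F N) ≠ 0 ↔ Function.Injective x := by
  rw [← Matrix.det_vandermonde_ne_zero_iff, vander, map_zsmul, zsmul_eq_mul, RingHom.map_det]
  have : (MvPolynomial.eval x).mapMatrix (Matrix.vandermonde
      (MvPolynomial.X : Fin N → MvPolynomial (Fin N) F)) = Matrix.vandermonde x := by
    ext i j; simp [Matrix.vandermonde_apply]
  rw [this, mul_ne_zero_iff]
  exact and_iff_right (Int.cast_ne_zero.2 (Units.ne_zero _))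

theorem fallingMatrix_mul (e : ℤ → F) (a : ℕ → F) {μ : YoungDiagram} (h : length μ ≤ N) :
    (fallingMatrix e N (stair μ N)).det = vander F N * evalShift e a N (multiSchur e a μ) := by
  rw [det_fallingMatrix e a, det_fallingMatrix_staircase, genDet_stair e a h]

theorem hasTop_det_fallingMatrix (e : ℤ → F) (f : Fin N → ℕ) :
    HasTop (∑ k, f k) (fallingMatrix e N f).det
      (fallingMatrix (0 : ℤ → F) N f).det := by
  rw [Matrix.det_apply, Matrix.det_apply]
  refine HasTop.sum _ fun w => ?_
  rw [Units.smul_def, Units.smul_def]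
  refine HasTop.zsmul (HasTop.prod _ fun k => ?_) _
  have h1 : ∀ l : ℕ, l = ∑ _k ∈ Finset.range l, 1 := fun l => by simp
  rw [h1 (f k)]
  refine HasTop.prod _ fun l => ?_
  simp only [Pi.zero_apply, map_zero, sub_zero]
  exact hasTop_X_sub_C _ _

theorem isHomogeneous_vander : (vander F N).IsHomogeneous (∑ k : Fin N, (N - 1 - (k : ℕ))) := by
  rw [← det_fallingMatrix_staircase (0 : ℤ → F)]
  exact (hasTop_det_fallingMatrix (0 : ℤ → F) _).1

theorem hasTop_evalShift (e : ℤ → F) (a : ℕ → F) {μ : YoungDiagram} (h : length μ ≤ N) :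
    HasTop μ.card (evalShift e a N (multiSchur e a μ))
      (evalShift (0 : ℤ → F) 0 N (multiSchur 0 0 μ)) := by
  refine HasTop.of_mul isHomogeneous_vander vander_ne_zero ?_
  rw [← fallingMatrix_mul e a h, ← fallingMatrix_mul 0 0 h, add_comm, ← sum_stair h]
  exact hasTop_det_fallingMatrix e _

theorem evalShift_isSymmetric (e : ℤ → F) (a : ℕ → F) (f : Sym F) :
    (evalShift e a N f).IsSymmetric := by
  intro w
  have : (MvPolynomial.rename w : MvPolynomial (Fin N) F →ₐ[F] _).comp (evalShift e a N) =
      evalShift e a N := by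
    refine MvPolynomial.algHom_ext fun n => ?_
    rw [AlgHom.comp_apply, evalShift, MvPolynomial.aeval_X, map_add, MvPolynomial.rename_C,
      MvPolynomial.psum_isSymmetric (Fin N) F n w]
  exact DFunLike.congr_fun this f

end FallingMatrix
end InterpMac
end

noncomputable section
set_option linter.unusedSectionVars false
namespace InterpMac

theorem perm_eq_of_strictAnti {N : ℕ} {f g : Fin N → ℕ} (hf : StrictAnti f) (hg : StrictAnti g)
    {w : Equiv.Perm (Fin N)} (h : f ∘ w = g) : f = g ∧ w = 1 := by
  have h1 : f = g := by
    have hf' : StrictMono (f ∘ Fin.rev) := fun i j hij => hf (Fin.rev_lt_rev.2 hij)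
    have hg' : StrictMono (g ∘ Fin.rev) := fun i j hij => hg (Fin.rev_lt_rev.2 hij)
    have h2 := (hf'.range_inj hg').1 (by
      rw [← h, Fin.rev_surjective.range_comp, Fin.rev_surjective.range_comp,
        w.surjective.range_comp])
    funext i
    simpa using congrFun h2 i.rev
  refine ⟨h1, Equiv.ext fun i => hf.injective ?_⟩
  rw [Equiv.Perm.one_apply]
  exact (congrFun h i).trans (congrFun h1 i).symm

/-! ### Vanishing, and uniqueness of interpolation at the nodes -/

section Nodes

variable {F : Type*} [Field F] [CharZero F] {N : ℕ} {q : F}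

/-- The parameters `q ^ k`. -/
def qParam (q : F) (k : ℤ) : F := q ^ k

/-- A finite geometric sum: q^(Nn)/(1 - q^n) = 1/(1 - q^n) - Σ_{k<N} q^(kn). -/
theorem phi_eq_evalShift (hq : ∀ n : ℕ, 1 ≤ n → q ^ n ≠ 1) (N : ℕ) :
    phi q N = evalShift (qParam q) (qShift q) N := by
  refine MvPolynomial.algHom_ext fun n => ?_
  rw [phi, evalShift, MvPolynomial.aeval_X, MvPolynomial.aeval_X]
  congr 2
  have h1 : 1 - q ^ (n : ℕ) ≠ 0 := sub_ne_zero.2 (hq n n.2).symm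
  have h2 : ∑ k : Fin N, qParam q (k : ℕ) ^ (n : ℕ) = ∑ k ∈ Finset.range N, (q ^ (n : ℕ)) ^ k := by
    rw [Finset.sum_range]
    refine Finset.sum_congr rfl fun k _ => ?_
    rw [qParam, zpow_natCast, ← pow_mul, ← pow_mul, mul_comm]
  rw [h2, geom_sum_eq (hq n n.2), qShift, ← pow_mul, mul_comm N, ← neg_sub 1 (q ^ (n : ℕ)),
    div_neg, sub_neg_eq_add, ← add_div]
  ring

theorem restrict_eq_evalShift (N : ℕ) : restrict F N = evalShift 0 0 N := by
  refine MvPolynomial.algHom_ext fun n => ?_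
  rw [restrict, evalShift, MvPolynomial.aeval_X, MvPolynomial.aeval_X]
  simp [n.ne_zero]

theorem zpow_injective_of_pow_ne_one (hq0 : q ≠ 0) (hq : ∀ n : ℕ, 1 ≤ n → q ^ n ≠ 1) :
    Function.Injective fun z : ℤ => q ^ z := by
  have key : ∀ (z : ℤ) (n : ℕ), q ^ z = q ^ (z + (n + 1 : ℕ)) → False := by
    intro z n h
    rw [zpow_add₀ hq0, zpow_natCast] at h
    exact hq (n + 1) (by omega) (mul_left_cancel₀ (zpow_ne_zero z hq0) (by rw [← h, mul_one]))
  intro a b h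
  rcases lt_trichotomy a b with hab | hab | hab
  · exact (key a (b - a - 1).toNat (by
      rw [show a + (((b - a - 1).toNat + 1 : ℕ) : ℤ) = b by omega]; exact h)).elim
  · exact hab
  · exact (key b (a - b - 1).toNat (by
      rw [show b + (((a - b - 1).toNat + 1 : ℕ) : ℤ) = a by omega]; exact h.symm)).elim

theorem node_eq (hq0 : q ≠ 0) (lam : YoungDiagram) (i : Fin N) :
    node q q N lam i = q ^ ((N : ℤ) - 1 - stair lam N i) := by
  rw [node, ← zpow_natCast, ← zpow_add₀ hq0, stair]
  congr 1
  have := i.2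
  omega

theorem node_injective (hq0 : q ≠ 0) (hq : ∀ n : ℕ, 1 ≤ n → q ^ n ≠ 1) (lam : YoungDiagram) :
    Function.Injective (node q q N lam) := by
  intro i j h
  rw [node_eq hq0, node_eq hq0] at h
  have := zpow_injective_of_pow_ne_one hq0 hq h
  exact (stair_strictAnti lam N).injective (by omega)

theorem fallingPow_eq_zero_iff (hq0 : q ≠ 0) (hq : ∀ n : ℕ, 1 ≤ n → q ^ n ≠ 1) (m l : ℕ) :
    fallingPow (qParam q) N (q ^ ((N : ℤ) - 1 - m)) l = 0 ↔ m < l := by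
  rw [fallingPow, Finset.prod_eq_zero_iff]
  constructor
  · rintro ⟨k, hk, h⟩
    have := zpow_injective_of_pow_ne_one hq0 hq (sub_eq_zero.1 h)
    have := Finset.mem_range.1 hk
    omega
  · exact fun h => ⟨m, Finset.mem_range.2 h, sub_self _⟩

theorem eval_det_fallingMatrix (hq0 : q ≠ 0) (lam : YoungDiagram) (f : Fin N → ℕ) :
    MvPolynomial.eval (node q q N lam) (fallingMatrix (qParam q) N f).det =
      (Matrix.of fun i k : Fin N =>
        fallingPow (qParam q) N (q ^ ((N : ℤ) - 1 - stair lam N i)) (f k)).det := by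
  rw [RingHom.map_det]
  congr 1
  ext1 i k
  simp [fallingMatrix, fallingPow, node_eq hq0]

/-- A nonzero term of the determinant requires `stair μ N ≤ stair lam N ∘ w` entrywise. As |λ| ≤
|μ|, comparing sums makes this an equality, and then λ = μ. -/
theorem eval_node_eq_zero (hq0 : q ≠ 0) (hq : ∀ n : ℕ, 1 ≤ n → q ^ n ≠ 1) {μ lam : YoungDiagram}
    (hμ : length μ ≤ N) (hlam : length lam ≤ N) (hne : lam ≠ μ) (hcard : lam.card ≤ μ.card) :
    MvPolynomial.eval (node q q N lam) (evalShift (qParam q) (qShift q) N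
      (multiSchur (qParam q) (qShift q) μ)) = 0 := by
  have h := congrArg (MvPolynomial.eval (node q q N lam))
    (fallingMatrix_mul (qParam q) (qShift q) hμ)
  rw [map_mul, eval_det_fallingMatrix hq0] at h
  refine (mul_eq_zero.1 (h.symm.trans ?_)).resolve_left
    ((eval_vander_ne_zero_iff _).2 (node_injective hq0 hq lam))
  rw [Matrix.det_apply]
  refine Finset.sum_eq_zero fun w _ => ?_
  by_contra hprod
  apply hne
  have h1 : ∀ k, stair μ N k ≤ stair lam N (w k) := by
    intro k
    by_contra hk
    refine hprod ?_
    rw [Finset.prod_eq_zero (Finset.mem_univ k), smul_zero]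
    rw [Matrix.of_apply, fallingPow_eq_zero_iff hq0 hq]
    omega
  have h2 : ∑ k, stair lam N (w k) ≤ ∑ k, stair μ N k := by
    rw [Equiv.sum_comp w (stair lam N), sum_stair hlam, sum_stair hμ]
    omega
  have h3 := (Finset.sum_eq_sum_iff_of_le fun k _ => h1 k).1
    (le_antisymm (Finset.sum_le_sum fun k _ => h1 k) h2)
  have h4 : stair lam N ∘ w = stair μ N := funext fun k => (h3 k (Finset.mem_univ k)).symm
  exact eq_of_stair_eq hlam hμ
    (perm_eq_of_strictAnti (stair_strictAnti lam N) (stair_strictAnti μ N) h4).1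

theorem eval_node_self_ne_zero (hq0 : q ≠ 0) (hq : ∀ n : ℕ, 1 ≤ n → q ^ n ≠ 1) {μ : YoungDiagram}
    (hμ : length μ ≤ N) : MvPolynomial.eval (node q q N μ) (evalShift (qParam q) (qShift q) N
      (multiSchur (qParam q) (qShift q) μ)) ≠ 0 := by
  intro h0
  have h := congrArg (MvPolynomial.eval (node q q N μ))
    (fallingMatrix_mul (qParam q) (qShift q) hμ)
  rw [map_mul, eval_det_fallingMatrix hq0, h0, mul_zero, Matrix.det_of_isUpperTriangular] at h
  · obtain ⟨k, -, hk⟩ := Finset.prod_eq_zero_iff.1 h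
    rw [Matrix.of_apply, fallingPow_eq_zero_iff hq0 hq] at hk
    exact lt_irrefl _ hk
  · intro i k hik
    rw [Matrix.of_apply, fallingPow_eq_zero_iff hq0 hq]
    exact stair_strictAnti μ N hik

/-- The Combinatorial Nullstellensatz applied to g times the Vandermonde polynomial gives a point
with coordinates q^(N-1-m_i), m_i ≤ t_i, where both are nonzero. The Vandermonde factor makes the
m_i distinct, so the point is a permuted node of some λ, and Σ m_i ≤ Σ t_i gives |λ| ≤ deg g. -/
theorem eq_zero_of_eval_node_eq_zero (hq0 : q ≠ 0) (hq : ∀ n : ℕ, 1 ≤ n → q ^ n ≠ 1)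
    {g : MvPolynomial (Fin N) F} (hg : g.IsSymmetric)
    (h : ∀ lam : YoungDiagram, length lam ≤ N → lam.card ≤ g.totalDegree →
      MvPolynomial.eval (node q q N lam) g = 0) : g = 0 := by
  classical
  by_contra hg0
  have hG0 : g * vander F N ≠ 0 := mul_ne_zero hg0 vander_ne_zero
  obtain ⟨t, ht, hdeg⟩ := exists_degree_eq_totalDegree hG0
  have hinj : Function.Injective fun m : ℕ => q ^ ((N : ℤ) - 1 - m) := fun a b hab => by
    have := zpow_injective_of_pow_ne_one hq0 hq hab
    omega
  obtain ⟨x, hx, hne⟩ := MvPolynomial.combinatorial_nullstellensatz_exists_eval_nonzero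
    (g * vander F N) t (MvPolynomial.mem_support_iff.1 ht) hdeg.symm
    (fun i => (Finset.range (t i + 1)).image fun m : ℕ => q ^ ((N : ℤ) - 1 - m))
    (fun i => by rw [Finset.card_image_of_injective _ hinj, Finset.card_range]; omega)
  simp only [Finset.mem_image, Finset.mem_range] at hx
  choose m hm hmx using hx
  rw [map_mul] at hne
  have hxinj := (eval_vander_ne_zero_iff x).1 (right_ne_zero_of_mul hne)
  have hminj : Function.Injective m := fun i j hij => hxinj (by rw [← hmx, ← hmx, hij])
  obtain ⟨lam, hlam, w, hw⟩ := exists_stair_comp_perm hminj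
  have hxw : x = node q q N lam ∘ w := by
    funext i
    rw [← hmx, Function.comp_apply, node_eq hq0, hw, Function.comp_apply]
  refine left_ne_zero_of_mul hne ?_
  rw [hxw, ← MvPolynomial.eval_rename, hg w]
  refine h lam hlam ?_
  have h1 : ∑ i, m i ≤ ∑ i, t i := Finset.sum_le_sum fun i _ => Nat.lt_succ_iff.1 (hm i)
  rw [hw] at h1
  have h2 : ∑ i, (stair lam N ∘ w) i = _ := (Equiv.sum_comp w (stair lam N)).trans (sum_stair hlam)
  rw [h2, ← Finsupp.degree_eq_sum, hdeg, MvPolynomial.totalDegree_mul_of_isDomain hg0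
    vander_ne_zero, isHomogeneous_vander.totalDegree vander_ne_zero] at h1
  omega

/-- At the node of a partition of minimal size in the support only its own term survives. -/
theorem linearCombination_eq_zero (hq0 : q ≠ 0) (hq : ∀ n : ℕ, 1 ≤ n → q ^ n ≠ 1)
    (b : YoungDiagram →₀ F) (M : ℕ)
    (h : ∀ N, M ≤ N → phi q N (Finsupp.linearCombination F
      (multiSchur (qParam q) (qShift q)) b) = 0) : b = 0 := by
  classical
  by_contra hb
  obtain ⟨μ, hμ, hmin⟩ := Finset.exists_min_image b.support YoungDiagram.card
    (Finsupp.support_nonempty_iff.2 hb)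
  obtain ⟨N, hMN, hN⟩ : ∃ N, M ≤ N ∧ ∀ ν ∈ b.support, length ν ≤ N :=
    ⟨M + ∑ ν ∈ b.support, length ν, Nat.le_add_right _ _, fun ν hν =>
      (Finset.single_le_sum (f := length) (fun _ _ => Nat.zero_le _) hν).trans
        (Nat.le_add_left _ _)⟩
  have h1 := congrArg (MvPolynomial.eval (node q q N μ)) (h N hMN)
  rw [phi_eq_evalShift hq, Finsupp.linearCombination_apply, Finsupp.sum, map_sum, map_sum,
    map_zero, Finset.sum_eq_single μ] at h1
  · rw [map_smul, MvPolynomial.smul_eval] at h1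
    exact (mul_ne_zero (Finsupp.mem_support_iff.1 hμ)
      (eval_node_self_ne_zero hq0 hq (hN μ hμ))) h1
  · intro ν hν hne
    rw [map_smul, MvPolynomial.smul_eval, eval_node_eq_zero hq0 hq (hN ν hν) (hN μ hμ) hne.symm
      (hmin ν hν), mul_zero]
  · exact fun hn => absurd hμ hn

theorem linearIndependent_multiSchur (hq0 : q ≠ 0) (hq : ∀ n : ℕ, 1 ≤ n → q ^ n ≠ 1) :
    LinearIndependent F (multiSchur (qParam q) (qShift q)) :=
  linearIndependent_iff.2 fun b hb => linearCombination_eq_zero hq0 hq b 0 fun N _ => by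
    rw [hb, map_zero]

theorem eq_of_phi_eq (hq0 : q ≠ 0) (hq : ∀ n : ℕ, 1 ≤ n → q ^ n ≠ 1) {f g : Sym F} (M : ℕ)
    (h : ∀ N, M ≤ N → phi q N f = phi q N g) : f = g := by
  have hmem : f - g ∈ Submodule.span F (Set.range (multiSchur (qParam q) (qShift q))) := by
    rw [span_multiSchur]; trivial
  obtain ⟨b, hb⟩ := Finsupp.mem_span_range_iff_exists_finsupp.1 hmem
  have hb0 := linearCombination_eq_zero hq0 hq b M fun N hN => by
    rw [Finsupp.linearCombination_apply, hb, map_sub, h N hN, sub_self]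
  rw [hb0, Finsupp.sum_zero_index] at hb
  exact (sub_eq_zero.1 hb.symm)

end Nodes
end InterpMac
end

noncomputable section
set_option linter.unusedSectionVars false
namespace InterpMac

/-! ### Unitriangularity of Schur functions in the dominance order -/

section Monomials

variable {F : Type*} [Field F] [CharZero F] {N : ℕ}

/-- The exponent vector with the entries `f i`. -/
def vec (f : Fin N → ℕ) : Fin N →₀ ℕ := Finsupp.equivFunOnFinite.symm f

theorem coe_vec (f : Fin N → ℕ) : ⇑(vec f) = f := rfl

theorem vec_apply (f : Fin N → ℕ) (i : Fin N) : vec f i = f i := rfl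

theorem coeff_det_fallingMatrix_zero (f : Fin N → ℕ) (d : Fin N →₀ ℕ) :
    MvPolynomial.coeff d (fallingMatrix (0 : ℤ → F) N f).det =
      ∑ w : Equiv.Perm (Fin N), if d ∘ w = f then (((Equiv.Perm.sign w : ℤˣ) : ℤ) : F) else 0 := by
  classical
  rw [Matrix.det_apply, MvPolynomial.coeff_sum]
  refine Finset.sum_congr rfl fun w _ => ?_
  have h1 : ∏ i, fallingMatrix (0 : ℤ → F) N f (w i) i =
      MvPolynomial.monomial (vec (f ∘ w.symm)) 1 := by
    rw [MvPolynomial.monomial_eq, map_one, one_mul, Finsupp.prod_fintype _ _ (by simp),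
      ← Equiv.prod_comp w (fun i => (MvPolynomial.X i : MvPolynomial (Fin N) F) ^
        vec (f ∘ w.symm) i)]
    refine Finset.prod_congr rfl fun i _ => ?_
    simp [fallingMatrix, fallingPow, vec_apply]
  rw [h1, Units.smul_def, MvPolynomial.coeff_smul, MvPolynomial.coeff_monomial]
  have h2 : vec (f ∘ w.symm) = d ↔ d ∘ w = f := by
    rw [← Equiv.eq_comp_symm, DFunLike.ext'_iff, eq_comm]; rfl
  simp only [h2]
  split_ifs <;> simp

theorem exists_perm_of_coeff_ne_zero {f : Fin N → ℕ} {d : Fin N →₀ ℕ}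
    (h : MvPolynomial.coeff d (fallingMatrix (0 : ℤ → F) N f).det ≠ 0) :
    ∃ w : Equiv.Perm (Fin N), d ∘ w = f := by
  rw [coeff_det_fallingMatrix_zero] at h
  obtain ⟨w, -, hw⟩ := Finset.exists_ne_zero_of_sum_ne_zero h
  exact ⟨w, by by_contra hc; exact hw (if_neg hc)⟩

theorem coeff_det_fallingMatrix_self {f : Fin N → ℕ} (hf : StrictAnti f) :
    MvPolynomial.coeff (vec f) (fallingMatrix (0 : ℤ → F) N f).det = 1 := by
  rw [coeff_det_fallingMatrix_zero, Finset.sum_eq_single 1]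
  · rw [if_pos (by ext i; rfl)]; simp
  · intro w _ hw
    exact if_neg fun h => hw (perm_eq_of_strictAnti hf hf h).2
  · simp

/-- The sum of the first `k` entries. -/
def partSum (k : ℕ) (d : Fin N → ℕ) : ℕ := ∑ i, d i * if (i : ℕ) < k then 1 else 0

theorem partSum_add (k : ℕ) (d d' : Fin N → ℕ) :
    partSum k (d + d') = partSum k d + partSum k d' := by
  simp only [partSum, Pi.add_apply, add_mul, Finset.sum_add_distrib]

theorem partSum_succ {k : ℕ} (hk : k < N) (d : Fin N → ℕ) :
    partSum (k + 1) d = partSum k d + d ⟨k, hk⟩ := by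
  have : d ⟨k, hk⟩ = ∑ i, d i * if i = ⟨k, hk⟩ then 1 else 0 := by simp
  rw [this, partSum, partSum, ← Finset.sum_add_distrib]
  refine Finset.sum_congr rfl fun i _ => ?_
  have hi : i = ⟨k, hk⟩ ↔ (i : ℕ) = k := Fin.ext_iff
  simp only [← mul_add, hi]
  congr 1
  split_ifs <;> omega

theorem eq_of_partSum_eq {d d' : Fin N → ℕ} (h : ∀ k, k ≤ N → partSum k d = partSum k d') :
    d = d' := by
  funext i
  have h1 := h (i + 1) i.2
  rw [partSum_succ i.2, partSum_succ i.2, h i i.2.le] at h1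
  exact add_left_cancel h1

theorem partSum_rowLen (μ : YoungDiagram) {k : ℕ} (hk : k ≤ N) :
    partSum k (fun i : Fin N => μ.rowLen i) = ∑ i ∈ Finset.range k, μ.rowLen i := by
  induction k with
  | zero => simp [partSum]
  | succ k ih => rw [partSum_succ hk, ih (by omega), Finset.sum_range_succ]

theorem partSum_le_of_comp_perm {f : Fin N → ℕ} (hf : Antitone f) {d : Fin N → ℕ}
    {w : Equiv.Perm (Fin N)} (h : d ∘ w = f) (k : ℕ) : partSum k d ≤ partSum k f := by
  have h1 : d = f ∘ w.symm := by rw [← h]; funext i; simp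
  rw [h1]
  refine Monovary.sum_comp_perm_mul_le_sum_mul ?_
  refine Antitone.monovary hf ?_
  intro i j hij
  have hij' : (i : ℕ) ≤ j := hij
  dsimp only
  split_ifs
  · exact le_rfl
  · omega
  · exact Nat.zero_le _
  · exact le_rfl

/-- Exponents in the Vandermonde polynomial are permutations of the staircase δ, with partial sums
at most those of δ. If such an exponent plus y equals δ + d, then y has partial sums at least those
of d, so y = d by the maximality hypothesis. -/
theorem coeff_vander_mul (p : MvPolynomial (Fin N) F) (d : Fin N →₀ ℕ)
    (h : ∀ y, MvPolynomial.coeff y p ≠ 0 → (∀ k, partSum k d ≤ partSum k y) → y = d) :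
    MvPolynomial.coeff (vec (stair ⊥ N) + d) (vander F N * p) = MvPolynomial.coeff d p := by
  classical
  have hV : vander F N = (fallingMatrix (0 : ℤ → F) N (stair ⊥ N)).det := by
    rw [← det_fallingMatrix_staircase (0 : ℤ → F), stair_bot]
  have hanti := stair_strictAnti ⊥ N
  rw [MvPolynomial.coeff_mul, Finset.sum_eq_single (vec (stair ⊥ N), d)]
  · rw [hV, coeff_det_fallingMatrix_self hanti, one_mul]
  · rintro ⟨x, y⟩ hxy hne
    by_contra hprod
    have hxy' := Finset.HasAntidiagonal.mem_antidiagonal.1 hxy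
    dsimp only at hxy' hprod
    rw [hV] at hprod
    obtain ⟨w, hw⟩ := exists_perm_of_coeff_ne_zero (left_ne_zero_of_mul hprod)
    have hy : y = d := h y (right_ne_zero_of_mul hprod) fun k => by
      have h1 := partSum_le_of_comp_perm hanti.antitone hw k
      have h2 := congrArg (fun z : Fin N →₀ ℕ => partSum k z) hxy'
      simp only [Finsupp.coe_add, partSum_add, coe_vec] at h2
      omega
    rw [hy] at hxy'
    exact hne (Prod.ext (add_right_cancel hxy') hy)
  · intro hn
    exact (hn (by rw [Finset.HasAntidiagonal.mem_antidiagonal])).elim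

theorem vander_mul_restrict {μ : YoungDiagram} (hμ : length μ ≤ N) :
    vander F N * restrict F N (multiSchur 0 0 μ) =
      (fallingMatrix (0 : ℤ → F) N (stair μ N)).det := by
  rw [fallingMatrix_mul 0 0 hμ, restrict_eq_evalShift]

theorem vec_stair_eq (μ : YoungDiagram) :
    vec (stair μ N) = vec (stair ⊥ N) + vec fun i : Fin N => μ.rowLen i := by
  ext i
  rw [Finsupp.add_apply, vec_apply, vec_apply, vec_apply, stair_bot, stair, add_comm]

theorem partSum_le_of_coeff_restrict_ne_zero {μ : YoungDiagram} (hμ : length μ ≤ N)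
    {d : Fin N →₀ ℕ} (h : MvPolynomial.coeff d (restrict F N (multiSchur 0 0 μ)) ≠ 0) (k : ℕ) :
    partSum k d ≤ partSum k fun i : Fin N => μ.rowLen i := by
  classical
  by_contra hk
  set p := restrict F N (multiSchur 0 0 μ)
  -- A violating exponent y with maximal total of partial sums satisfies the hypothesis of
  -- `coeff_vander_mul`, so δ + y occurs in the alternant of μ and is a permutation of `stair μ N`,
  -- which bounds its partial sums.
  obtain ⟨y, hy, hmax⟩ := Finset.exists_max_image
    (p.support.filter fun y : Fin N →₀ ℕ => ¬ partSum k y ≤ partSum k fun i : Fin N => μ.rowLen i)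
    (fun y : Fin N →₀ ℕ => ∑ j ∈ Finset.range (N + 1), partSum j y)
    ⟨d, Finset.mem_filter.2 ⟨MvPolynomial.mem_support_iff.2 h, hk⟩⟩
  obtain ⟨hy1, hy2⟩ := Finset.mem_filter.1 hy
  have h1 := coeff_vander_mul p y fun z hz hyz => by
    have h2 := hmax z (Finset.mem_filter.2 ⟨MvPolynomial.mem_support_iff.2 hz,
      fun hc => hy2 ((hyz k).trans hc)⟩)
    have h3 := (Finset.sum_eq_sum_iff_of_le fun j _ => hyz j).1
      (le_antisymm (Finset.sum_le_sum fun j _ => hyz j) h2)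
    exact (DFunLike.coe_injective (eq_of_partSum_eq fun j hj =>
      h3 j (Finset.mem_range.2 (Nat.lt_succ_of_le hj)))).symm
  rw [vander_mul_restrict hμ] at h1
  obtain ⟨w, hw⟩ := exists_perm_of_coeff_ne_zero (h1.trans_ne (MvPolynomial.mem_support_iff.1 hy1))
  have h4 := partSum_le_of_comp_perm (stair_strictAnti μ N).antitone hw k
  rw [← coe_vec (stair μ N), vec_stair_eq μ, Finsupp.coe_add, Finsupp.coe_add, partSum_add,
    partSum_add, coe_vec fun i : Fin N => μ.rowLen i] at h4
  omega

theorem coeff_restrict_self {μ : YoungDiagram} (hμ : length μ ≤ N) :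
    MvPolynomial.coeff (vec fun i : Fin N => μ.rowLen i) (restrict F N (multiSchur 0 0 μ)) = 1 := by
  rw [← coeff_vander_mul, vander_mul_restrict hμ, ← vec_stair_eq,
    coeff_det_fallingMatrix_self (stair_strictAnti μ N)]
  intro y hy h
  exact DFunLike.coe_injective (eq_of_partSum_eq fun k _ =>
    le_antisymm (partSum_le_of_coeff_restrict_ne_zero hμ hy k) (h k))

theorem restrict_isHomogeneous {μ : YoungDiagram} (hμ : length μ ≤ N) :
    (restrict F N (multiSchur 0 0 μ)).IsHomogeneous μ.card := by
  rw [restrict_eq_evalShift]; exact (hasTop_evalShift 0 0 hμ).1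

theorem rowExponent_eq {ν : YoungDiagram} (hν : length ν ≤ N) :
    rowExponent ν = Finsupp.embDomain (Fin.valEmbedding : Fin N ↪ ℕ)
      (vec fun i : Fin N => ν.rowLen i) := by
  ext i
  by_cases hi : i < N
  · exact (Finsupp.embDomain_apply_self (Fin.valEmbedding : Fin N ↪ ℕ)
      (vec fun i : Fin N => ν.rowLen i) ⟨i, hi⟩).symm
  · rw [Finsupp.embDomain_of_notMem_range]
    · exact (rowLen_eq_zero_iff ν i).2 (by omega)
    · rintro ⟨j, rfl⟩
      exact hi j.2

theorem killCompl_toSeries (N : ℕ) (f : Sym F) :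
    MvPowerSeries.killCompl (Fin.valEmbedding : Fin N ↪ ℕ) (toSeries F f) =
      (restrict F N f : MvPowerSeries (Fin N) F) := by
  classical
  have h : (MvPowerSeries.killCompl (Fin.valEmbedding : Fin N ↪ ℕ)).comp (toSeries F) =
      (MvPolynomial.coeToMvPowerSeries.algHom F).comp (restrict F N) := by
    refine MvPolynomial.algHom_ext fun n => ?_
    rw [AlgHom.comp_apply, AlgHom.comp_apply, toSeries, restrict, MvPolynomial.aeval_X,
      MvPolynomial.aeval_X, MvPolynomial.psum, map_sum]
    ext x
    rw [MvPowerSeries.coeff_killCompl, map_sum]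
    have h1 : ∀ i, MvPowerSeries.coeff x (MvPolynomial.coeToMvPowerSeries.algHom F
        ((MvPolynomial.X i : MvPolynomial (Fin N) F) ^ (n : ℕ))) =
        if x = Finsupp.single i (n : ℕ) then (1 : F) else 0 := by
      intro i
      rw [MvPolynomial.coeToMvPowerSeries.algHom_apply, MvPolynomial.coe_pow, MvPolynomial.coe_X]
      simp [MvPowerSeries.coeff_X_pow]
    rw [Finset.sum_congr rfl fun i _ => h1 i]
    change (if ∃ i : ℕ, x.embDomain Fin.valEmbedding = Finsupp.single i (n : ℕ) then (1 : F)
      else 0) = _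
    split_ifs with hx
    · obtain ⟨i, hi⟩ := hx
      have hiN : i < N := by
        by_contra hc
        have h2 := DFunLike.congr_fun hi i
        rw [Finsupp.single_eq_same, Finsupp.embDomain_of_notMem_range] at h2
        · exact n.ne_zero h2.symm
        · rintro ⟨j, rfl⟩
          exact hc j.2
      have hx : x = Finsupp.single ⟨i, hiN⟩ (n : ℕ) := by
        refine Finsupp.embDomain_injective Fin.valEmbedding ?_
        rw [hi, Finsupp.embDomain_single]; rfl
      rw [Finset.sum_eq_single ⟨i, hiN⟩, if_pos hx]
      · intro j _ hj
        refine if_neg fun hc => hj ?_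
        exact Finsupp.single_left_injective n.ne_zero (hc.symm.trans hx)
      · simp
    · symm
      refine Finset.sum_eq_zero fun i _ => if_neg fun hc => hx ⟨i, ?_⟩
      rw [hc, Finsupp.embDomain_single]; rfl
  exact DFunLike.congr_fun h f

theorem coeff_toSeries {ν : YoungDiagram} (hν : length ν ≤ N) (f : Sym F) :
    MvPowerSeries.coeff (rowExponent ν) (toSeries F f) =
      MvPolynomial.coeff (vec fun i : Fin N => ν.rowLen i) (restrict F N f) := by
  rw [rowExponent_eq hν, ← MvPowerSeries.coeff_killCompl, killCompl_toSeries,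
    MvPolynomial.coeff_coe]

theorem coeff_toSeries_self (μ : YoungDiagram) :
    MvPowerSeries.coeff (rowExponent μ) (toSeries F (multiSchur 0 0 μ)) = 1 := by
  rw [coeff_toSeries le_rfl, coeff_restrict_self le_rfl]

theorem dominates_of_coeff_toSeries_ne_zero {μ ν : YoungDiagram}
    (h : MvPowerSeries.coeff (rowExponent ν) (toSeries F (multiSchur 0 0 μ)) ≠ 0) :
    Dominates μ ν := by
  constructor
  · have hν := le_max_right (length μ) (length ν)
    have hμ := le_max_left (length μ) (length ν)
    rw [coeff_toSeries hν] at h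
    have h1 := (restrict_isHomogeneous (F := F) hμ) h
    have h2 : (vec fun i : Fin (max (length μ) (length ν)) => ν.rowLen i).degree = μ.card := by
      rw [Finsupp.degree_eq_weight_one]; exact h1
    rw [← h2, Finsupp.degree_eq_sum, card_eq_sum_rowLen hν, Finset.sum_range]
    rfl
  · intro k
    set N := max k (max (length μ) (length ν))
    have hk : k ≤ N := le_max_left _ _
    have hμ : length μ ≤ N := (le_max_left _ _).trans (le_max_right _ _)
    have hν : length ν ≤ N := (le_max_right _ _).trans (le_max_right _ _)
    rw [coeff_toSeries hν] at h
    have h1 := partSum_le_of_coeff_restrict_ne_zero hμ h k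
    rw [partSum_rowLen μ hk] at h1
    exact (partSum_rowLen ν hk).symm.trans_le h1

end Monomials

/-! ### Macdonald functions at t = q are Schur functions -/

section Orthogonality

variable {F : Type*} [Field F] [CharZero F] {q : F}

theorem dualDet_zero_eq (N : ℕ) (f : Fin N → ℕ) :
    dualDet (0 : ℤ → F) N f = ((fallingMatrix (0 : ℤ → F) N f).det : MvPowerSeries (Fin N) F) := by
  rw [dualDet, ← Matrix.det_transpose, ← MvPolynomial.coeToMvPowerSeries.ringHom_apply,
    RingHom.map_det]
  congr 1
  ext1 i k
  rw [Matrix.transpose_apply, Matrix.of_apply, RingHom.mapMatrix_apply, Matrix.map_apply]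
  have h1 : dualPow (fun l : ℕ => (0 : ℤ → F) ((N : ℤ) - 2 - l)) (f k) = PowerSeries.X ^ f k :=
    dualPow_zero_sequence _
  rw [h1, inVar, PowerSeries.subst_pow (PowerSeries.HasSubst.X i),
    PowerSeries.subst_X (PowerSeries.HasSubst.X i)]
  simp [fallingMatrix, fallingPow]

theorem restrictHat_coe (N : ℕ) (f : Sym F) :
    restrictHat F N (f : MvPowerSeries ℕ+ F) = (restrict F N f : MvPowerSeries (Fin N) F) := by
  rw [restrictHat, MvPowerSeries.subst_coe]
  have h : (MvPolynomial.aeval (psumSeries F N) : Sym F →ₐ[F] _) =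
      (MvPolynomial.coeToMvPowerSeries.algHom F).comp (restrict F N) := by
    refine MvPolynomial.algHom_ext fun n => ?_
    rw [AlgHom.comp_apply, restrict, MvPolynomial.aeval_X, MvPolynomial.aeval_X]
    simp [psumSeries]
  rw [h]
  simp

-- Compare coefficients at the exponent `stair μ N` in the Cauchy expansion with e = a = 0, for the
-- functional of pairing with the second function. By the reproducing property the left side is the
-- alternant of ν; on the right, where `dualPow` is X^l, only the pairing in question remains.
open Classical in
theorem pairing_multiSchur (hq : ∀ n : ℕ, 1 ≤ n → q ^ n ≠ 1) (μ ν : YoungDiagram) :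
    pairing q q (multiSchur (0 : ℤ → F) 0 μ) (multiSchur (0 : ℤ → F) 0 ν : MvPowerSeries ℕ+ F) =
      if μ = ν then 1 else 0 := by
  classical
  set N := max (length μ) (length ν)
  have hμ : length μ ≤ N := le_max_left _ _
  have hν : length ν ≤ N := le_max_right _ _
  set L := pairingMap q q (multiSchur (0 : ℤ → F) 0 ν : MvPowerSeries ℕ+ F)
  set D := (∑ k, stair μ N k) + 1
  have hD : ∀ k, stair μ N k < D := fun k =>
    Nat.lt_succ_of_le (Finset.single_le_sum (f := fun k => stair μ N k)
      (fun _ _ => Nat.zero_le _) (Finset.mem_univ k))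
  have h1 := coeff_functionalSeries_mul (0 : ℤ → F) 0 L (vec (stair μ N)) hD
  rw [← restrictHat_eq hq, restrictHat_coe, dualDet_zero_eq, det_fallingMatrix_staircase,
    ← MvPolynomial.coe_mul, mul_comm, vander_mul_restrict hν, MvPolynomial.coeff_coe] at h1
  have h2 : ∀ (n l : ℕ), PowerSeries.coeff n
      (dualPow (fun l : ℕ => (0 : ℤ → F) ((N : ℤ) - 2 - l)) l) = if n = l then 1 else 0 := by
    intro n l
    have : dualPow (fun l : ℕ => (0 : ℤ → F) ((N : ℤ) - 2 - l)) l = PowerSeries.X ^ l :=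
      dualPow_zero_sequence _
    rw [this, PowerSeries.coeff_X_pow]
  simp only [h2] at h1
  rw [Finset.sum_eq_single (fun k => ⟨stair μ N k, hD k⟩)] at h1
  · have h3 : ∏ k : Fin N, (if vec (stair μ N) k = stair μ N k then (1 : F) else 0) = 1 :=
      Finset.prod_eq_one fun k _ => if_pos rfl
    simp only [h3, mul_one] at h1
    have h4 : genDet (0 : ℤ → F) 0 N (fun k => stair μ N k) = multiSchur 0 0 μ := genDet_stair 0 0 hμ
    rw [h4] at h1
    rw [← pairingMap_apply, ← h1]
    split_ifs with h
    · rw [← h, coeff_det_fallingMatrix_self (stair_strictAnti μ N)]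
    · by_contra hc
      obtain ⟨w, hw⟩ := exists_perm_of_coeff_ne_zero hc
      exact h (eq_of_stair_eq hμ hν
        (perm_eq_of_strictAnti (stair_strictAnti μ N) (stair_strictAnti ν N) hw).1)
  · intro f _ hf
    obtain ⟨k, hk⟩ := Function.ne_iff.1 hf
    rw [Finset.prod_eq_zero (Finset.mem_univ k), mul_zero]
    exact if_neg fun hc => hk (Fin.ext hc.symm)
  · simp

theorem isMacdonaldFamily_multiSchur (hq : ∀ n : ℕ, 1 ≤ n → q ^ n ≠ 1) :
    IsMacdonaldFamily q q (multiSchur (0 : ℤ → F) 0) :=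
  ⟨coeff_toSeries_self, fun _ _ h => dominates_of_coeff_toSeries_ne_zero h,
    fun μ ν h => by rw [pairing_multiSchur hq, if_neg h]⟩

theorem Dominates.trans {μ ν κ : YoungDiagram} (h : Dominates μ ν) (h' : Dominates ν κ) :
    Dominates μ κ := ⟨h'.1.trans h.1, fun k => (h'.2 k).trans (h.2 k)⟩

/-- A statistic that is strictly increasing for the dominance order. -/
def domRank (μ : YoungDiagram) : ℕ :=
  ∑ k ∈ Finset.range (μ.card + 1), ∑ i ∈ Finset.range k, μ.rowLen i

theorem Dominates.eq_of_domRank_le {μ ν : YoungDiagram} (h : Dominates μ ν)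
    (hr : domRank μ ≤ domRank ν) : ν = μ := by
  rw [domRank, domRank, h.1] at hr
  have h1 := (Finset.sum_eq_sum_iff_of_le fun k _ => h.2 k).1
    (le_antisymm (Finset.sum_le_sum fun k _ => h.2 k) hr)
  refine eq_of_rowLen_eq fun i => ?_
  by_cases hi : i < μ.card
  · have h2 := h1 (i + 1) (Finset.mem_range.2 (by omega))
    rw [Finset.sum_range_succ, Finset.sum_range_succ, h1 i (Finset.mem_range.2 (by omega))] at h2
    exact add_left_cancel h2
  · have h3 := length_le_card μ
    have h4 := length_le_card ν
    have h5 := h.1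
    rw [(rowLen_eq_zero_iff μ i).2 (by omega), (rowLen_eq_zero_iff ν i).2 (by omega)]

/-- Both families are unitriangular over the monomial functions. By induction the lower members
agree, and orthogonality to them removes all lower terms from the Schur expansion of `P μ`. -/
theorem IsMacdonaldFamily.eq_multiSchur (hq : ∀ n : ℕ, 1 ≤ n → q ^ n ≠ 1)
    {P : YoungDiagram → Sym F} (hP : IsMacdonaldFamily q q P) (μ : YoungDiagram) :
    P μ = multiSchur 0 0 μ := by
  classical
  induction hr : domRank μ using Nat.strong_induction_on generalizing μ with
  | _ r ih =>
    obtain ⟨b, hb⟩ := Finsupp.mem_span_range_iff_exists_finsupp.1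
      (show P μ ∈ Submodule.span F (Set.range (multiSchur (0 : ℤ → F) 0)) by
        rw [span_multiSchur]; trivial)
    have hcoeff : ∀ ν, MvPowerSeries.coeff (rowExponent ν) (toSeries F (P μ)) =
        ∑ κ ∈ b.support, b κ *
          MvPowerSeries.coeff (rowExponent ν) (toSeries F (multiSchur 0 0 κ)) := by
      intro ν
      rw [← hb, Finsupp.sum, map_sum, map_sum]
      simp only [map_smul, smul_eq_mul]
    have h1 : ∀ ν, b ν ≠ 0 → Dominates μ ν := by
      intro ν hν
      by_contra hdom
      -- For an offending index of maximal rank no other term reaches its monomial, so the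
      -- coefficient of `P μ` there is b κ ≠ 0, against triangularity.
      obtain ⟨κ, hκ, hmax⟩ := Finset.exists_max_image
        (b.support.filter fun κ => ¬ Dominates μ κ) domRank
        ⟨ν, Finset.mem_filter.2 ⟨Finsupp.mem_support_iff.2 hν, hdom⟩⟩
      obtain ⟨hκ1, hκ2⟩ := Finset.mem_filter.1 hκ
      have h2 := hcoeff κ
      rw [Finset.sum_eq_single κ, coeff_toSeries_self, mul_one] at h2
      · exact hκ2 (hP.2.1 μ κ (h2.trans_ne (Finsupp.mem_support_iff.1 hκ1)))
      · intro l hl hne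
        by_contra hc
        have h3 := dominates_of_coeff_toSeries_ne_zero (right_ne_zero_of_mul hc)
        exact hne (h3.eq_of_domRank_le
          (hmax l (Finset.mem_filter.2 ⟨hl, fun h4 => hκ2 (h4.trans h3)⟩))).symm
      · exact fun hn => absurd hκ1 hn
    have h2 : b μ = 1 := by
      have h3 := hcoeff μ
      rw [hP.1, Finset.sum_eq_single μ, coeff_toSeries_self, mul_one] at h3
      · exact h3.symm
      · intro l hl hne
        by_contra hc
        have h4 := dominates_of_coeff_toSeries_ne_zero (right_ne_zero_of_mul hc)
        have h5 := h1 l (Finsupp.mem_support_iff.1 hl)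
        rcases le_total (domRank l) (domRank μ) with h6 | h6
        · exact hne (h4.eq_of_domRank_le h6).symm
        · exact hne (h5.eq_of_domRank_le h6)
      · intro hn
        rw [Finsupp.notMem_support_iff.1 hn, zero_mul]
    have h3 : ∀ ν, ν ≠ μ → b ν = 0 := by
      intro ν hne
      by_contra hν
      have h4 := h1 ν hν
      have h5 : domRank ν < domRank μ := lt_of_not_ge fun hc => hne (h4.eq_of_domRank_le hc)
      have h6 := hP.2.2 μ ν hne.symm
      rw [ih _ (hr ▸ h5) ν rfl, ← pairingMap_apply, ← hb, Finsupp.sum, map_sum,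
        Finset.sum_eq_single ν] at h6
      · rw [map_smul, pairingMap_apply, pairing_multiSchur hq, if_pos rfl, smul_eq_mul,
          mul_one] at h6
        exact hν h6
      · intro l _ hl
        rw [map_smul, pairingMap_apply, pairing_multiSchur hq, if_neg hl, smul_zero]
      · exact fun hn => absurd (Finsupp.mem_support_iff.2 hν) hn
    rw [← hb, Finsupp.sum, Finset.sum_eq_single μ, h2, one_smul]
    · intro l _ hl
      rw [h3 l hl, zero_smul]
    · intro hn
      rw [Finsupp.notMem_support_iff.1 hn, zero_smul]

theorem macdonaldP_eq (hq : ∀ n : ℕ, 1 ≤ n → q ^ n ≠ 1) :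
    macdonaldP q q = multiSchur (0 : ℤ → F) 0 :=
  funext fun μ => IsMacdonaldFamily.eq_multiSchur hq
    (Classical.epsilon_spec ⟨_, isMacdonaldFamily_multiSchur hq⟩) μ

end Orthogonality
end InterpMac
end

noncomputable section
set_option linter.unusedSectionVars false
namespace InterpMac

/-! ### Identification of the interpolation functions and their duals -/

section Interpolation

variable {F : Type*} [Field F] [CharZero F] {N : ℕ} {q : F}

theorem isInterpPoly_multiSchur (hq0 : q ≠ 0) (hq : ∀ n : ℕ, 1 ≤ n → q ^ n ≠ 1)
    {μ : YoungDiagram} (hμ : length μ ≤ N) :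
    IsInterpPoly q q N μ (phi q N (multiSchur (qParam q) (qShift q) μ)) := by
  have htop := hasTop_evalShift (N := N) (qParam q) (qShift q) hμ
  rw [← restrict_eq_evalShift] at htop
  have hne : restrict F N (multiSchur 0 0 μ) ≠ 0 := fun h => by
    have := coeff_restrict_self (F := F) hμ
    rw [h, MvPolynomial.coeff_zero] at this
    exact zero_ne_one this
  rw [phi_eq_evalShift hq]
  exact
    { symmetric := evalShift_isSymmetric _ _ _
      degree := htop.totalDegree_eq hne
      vanishing := fun lam hlam h1 h2 => eval_node_eq_zero hq0 hq hμ hlam h1 h2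
      nonvanishing := eval_node_self_ne_zero hq0 hq hμ
      leading := by rw [htop.homogeneousComponent_eq, macdonaldP_eq hq] }

/-- Equal leading terms give the difference degree below |μ|, so it vanishes at all the nodes that
determine it. -/
theorem IsInterpPoly.unique (hq0 : q ≠ 0) (hq : ∀ n : ℕ, 1 ≤ n → q ^ n ≠ 1)
    {μ : YoungDiagram} {f g : MvPolynomial (Fin N) F} (hf : IsInterpPoly q q N μ f)
    (hg : IsInterpPoly q q N μ g) : f = g := by
  classical
  by_contra hne
  have hne' : f - g ≠ 0 := sub_ne_zero.2 hne
  have hdeg : (f - g).totalDegree < μ.card := by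
    refine DegreeLT.totalDegree_lt (fun d hd => ?_) hne'
    rcases hd.eq_or_lt with h | h
    · have h1 := congrArg (MvPolynomial.coeff d) (hf.leading.trans hg.leading.symm)
      rw [MvPolynomial.coeff_homogeneousComponent, MvPolynomial.coeff_homogeneousComponent,
        if_pos h.symm, if_pos h.symm] at h1
      rw [MvPolynomial.coeff_sub, h1, sub_self]
    · rw [MvPolynomial.coeff_sub, degreeLT_of_totalDegree_lt (n := d.degree)
        (by rw [hf.degree]; exact h) d le_rfl, degreeLT_of_totalDegree_lt (n := d.degree)
        (by rw [hg.degree]; exact h) d le_rfl, sub_zero]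
  refine hne' (eq_zero_of_eval_node_eq_zero hq0 hq (hf.symmetric.sub hg.symmetric)
    fun lam hlam hcard => ?_)
  have h1 : lam ≠ μ := by rintro rfl; omega
  rw [map_sub, hf.vanishing lam hlam h1 (by omega), hg.vanishing lam hlam h1 (by omega), sub_self]

theorem interpPoly_eq (hq0 : q ≠ 0) (hq : ∀ n : ℕ, 1 ≤ n → q ^ n ≠ 1) {μ : YoungDiagram}
    (hμ : length μ ≤ N) :
    interpPoly q q N μ = phi q N (multiSchur (qParam q) (qShift q) μ) :=
  IsInterpPoly.unique hq0 hq (Classical.epsilon_spec ⟨_, isInterpPoly_multiSchur hq0 hq hμ⟩)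
    (isInterpPoly_multiSchur hq0 hq hμ)

theorem interpFunction_eq (hq0 : q ≠ 0) (hq : ∀ n : ℕ, 1 ≤ n → q ^ n ≠ 1) (μ : YoungDiagram) :
    interpFunction q q μ = multiSchur (qParam q) (qShift q) μ := by
  have h : IsInterpFunction q q μ (multiSchur (qParam q) (qShift q) μ) :=
    fun N _ hN => (interpPoly_eq hq0 hq hN).symm
  have h' : IsInterpFunction q q μ (interpFunction q q μ) := Classical.epsilon_spec ⟨_, h⟩
  exact eq_of_phi_eq hq0 hq (max 1 (length μ)) fun N hN =>
    (h' N ((le_max_left _ _).trans hN) ((le_max_right _ _).trans hN)).trans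
      (h N ((le_max_left _ _).trans hN) ((le_max_right _ _).trans hN)).symm

/-- Existence suffices: the Cauchy identity uses only the defining pairings. The coordinate
functional of the basis `multiSchur` is represented by an element of the completion. -/
theorem isDualFunction_dualFunction (hq0 : q ≠ 0) (hq : ∀ n : ℕ, 1 ≤ n → q ^ n ≠ 1)
    (μ : YoungDiagram) : IsDualFunction q q μ (dualFunction q q μ) := by
  classical
  refine Classical.epsilon_spec (p := IsDualFunction q q μ) ?_
  have hli := linearIndependent_multiSchur hq0 hq
  let B := Module.Basis.span hli
  obtain ⟨L, hL⟩ := (B.coord μ).exists_extend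
  have hval : ∀ ν, L (multiSchur (qParam q) (qShift q) ν) = if ν = μ then 1 else 0 := by
    intro ν
    have h1 := DFunLike.congr_fun hL (B ν)
    have h2 : ((B ν : _) : Sym F) = multiSchur (qParam q) (qShift q) ν :=
      congrArg Subtype.val (Module.Basis.span_apply hli ν)
    rw [← h2]
    refine h1.trans ?_
    rw [Module.Basis.coord_apply, Module.Basis.repr_self, Finsupp.single_apply]
  obtain ⟨g, hg⟩ := exists_pairingMap_eq hq L
  refine ⟨g, ?_, fun ν hν => ?_⟩
  · rw [interpFunction_eq hq0 hq, ← pairingMap_apply, hg, hval, if_pos rfl]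
  · rw [interpFunction_eq hq0 hq, ← pairingMap_apply, hg, hval, if_neg hν]

theorem modifiedDual_mul_dualDet (hq0 : q ≠ 0) (hq : ∀ n : ℕ, 1 ≤ n → q ^ n ≠ 1) (N : ℕ)
    (μ : YoungDiagram) :
    modifiedDual q q N μ * (dualDet (qParam q) N fun i => N - 1 - (i : ℕ)) =
      if length μ ≤ N then dualDet (qParam q) N (stair μ N) else 0 := by
  have h := isDualFunction_dualFunction hq0 hq μ
  rw [modifiedDual, restrictHat_mul_qPochhammerInf hq]
  refine functionalSeries_mul_dualDet _ _ _ _ μ ?_ fun ν hν => ?_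
  · rw [pairingMap_apply, ← interpFunction_eq hq0 hq]; exact h.1
  · rw [pairingMap_apply, ← interpFunction_eq hq0 hq]; exact h.2 ν hν

/-- With u = 1/y, each factor y/(1 - cy) is 1/(u - c). -/
theorem algebraMap_inVar_dualPow {K : Type*} [Field K] [Algebra (MvPowerSeries (Fin N) F) K]
    [FaithfulSMul (MvPowerSeries (Fin N) F) K] (k : Fin N) (c : ℕ → F) (l : ℕ) :
    algebraMap (MvPowerSeries (Fin N) F) K (inVar k (dualPow c l)) =
      1 / shiftedPow (algebraMap (MvPowerSeries (Fin N) F) K (MvPowerSeries.X k))⁻¹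
        (fun i => algebraMap (MvPowerSeries (Fin N) F) K (MvPowerSeries.C (c i))) l := by
  set y := algebraMap (MvPowerSeries (Fin N) F) K (MvPowerSeries.X k)
  have hy : y ≠ 0 := (map_ne_zero_iff _ (FaithfulSMul.algebraMap_injective _ _)).2 fun h => by
    have h1 := congrArg (MvPowerSeries.coeff (Finsupp.single k 1)) h
    rw [MvPowerSeries.coeff_index_single_self_X, map_zero] at h1
    exact one_ne_zero h1
  have hX : inVar k (PowerSeries.X : PowerSeries F) = MvPowerSeries.X k :=
    PowerSeries.subst_X (PowerSeries.HasSubst.X k)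
  induction l with
  | zero =>
    rw [dualPow_zero, shiftedPow, Finset.prod_range_zero, div_one]
    have : inVar k (1 : PowerSeries F) = 1 := by
      rw [inVar, ← PowerSeries.coe_substAlgHom (PowerSeries.HasSubst.X k), map_one]
    rw [this, map_one]
  | succ l ih =>
    rw [dualPow_succ, inVar_mul, inVar_mul, map_mul, map_mul, ih, shiftedPow, shiftedPow,
      Finset.prod_range_succ, one_div, one_div, mul_inv, hX]
    congr 1
    have h1 := congrArg (fun A => algebraMap (MvPowerSeries (Fin N) F) K (inVar k A))
      (geom_mul (c l))
    have hsub : ∀ A B : PowerSeries F, inVar k (A - B) = inVar k A - inVar k B := fun A B =>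
      PowerSeries.subst_sub (PowerSeries.HasSubst.X k) A B
    have h1' : inVar k (1 : PowerSeries F) = 1 := by
      rw [inVar, ← PowerSeries.coe_substAlgHom (PowerSeries.HasSubst.X k), map_one]
    have hC : inVar k (PowerSeries.C (c l)) = MvPowerSeries.C (c l) := PowerSeries.subst_C _
    simp only [inVar_mul, hsub, h1', hX, hC, map_mul, map_sub, map_one] at h1
    refine eq_inv_of_mul_eq_one_left ?_
    rw [← h1, mul_sub, mul_sub]
    change y * _ * y⁻¹ - _ = _ * 1 - _ * (_ * y)
    field_simp
    rfl

end Interpolation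

end InterpMac
end

/-- The identity takes place in the fraction field of the ring of formal power series in
`y_1, …, y_N`, which contains the rational functions in the variables `u_j = y_j ^ (-1)`. The
parameters of the function on the right are `q ^ (N-2), q ^ (N-3), …`. -/
theorem corollary4 {F : Type*} [Field F] [CharZero F] (q : F) (hq0 : q ≠ 0)
    (hq : ∀ n : ℕ, 1 ≤ n → q ^ n ≠ 1) (N : ℕ) (hN : 1 ≤ N) (μ : YoungDiagram) :
    algebraMap (MvPowerSeries (Fin N) F) (FractionRing (MvPowerSeries (Fin N) F))
        (InterpMac.modifiedDual q q N μ) =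
      InterpMac.sigma N μ
        (fun j : Fin N =>
          (algebraMap (MvPowerSeries (Fin N) F) (FractionRing (MvPowerSeries (Fin N) F))
            (MvPowerSeries.X j))⁻¹)
        (fun k : ℕ =>
          algebraMap (MvPowerSeries (Fin N) F) (FractionRing (MvPowerSeries (Fin N) F))
            (MvPowerSeries.C (q ^ ((N : ℤ) - 2 - (k : ℤ))))) := by
  set K := FractionRing (MvPowerSeries (Fin N) F)
  have hdet : ∀ f : Fin N → ℕ, algebraMap (MvPowerSeries (Fin N) F) K
      (InterpMac.dualDet (InterpMac.qParam q) N f) = (Matrix.of fun i j : Fin N =>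
        1 / InterpMac.shiftedPow (algebraMap (MvPowerSeries (Fin N) F) K (MvPowerSeries.X j))⁻¹
          (fun k : ℕ => algebraMap (MvPowerSeries (Fin N) F) K
            (MvPowerSeries.C (q ^ ((N : ℤ) - 2 - (k : ℤ))))) (f i)).det := by
    intro f
    rw [InterpMac.dualDet, RingHom.map_det]
    congr 1
    ext1 i k
    exact InterpMac.algebraMap_inVar_dualPow (F := F) (K := K) k
      (fun l => InterpMac.qParam q ((N : ℤ) - 2 - l)) (f i)
  have h := congrArg (algebraMap (MvPowerSeries (Fin N) F) K)
    (InterpMac.modifiedDual_mul_dualDet hq0 hq N μ)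
  have h0 : algebraMap (MvPowerSeries (Fin N) F) K
      (InterpMac.dualDet (InterpMac.qParam q) N fun i => N - 1 - (i : ℕ)) ≠ 0 :=
    (map_ne_zero_iff _ (FaithfulSMul.algebraMap_injective _ _)).2
      (InterpMac.dualDet_staircase_ne_zero _ N)
  rw [map_mul] at h
  rw [InterpMac.sigma, InterpMac.schurType]
  -- If ℓ(μ) ≤ N, divide by the nonzero staircase determinant; otherwise its product with the
  -- modified dual function is zero, which forces the latter to vanish.
  split_ifs at h ⊢ with hμ
  · rw [eq_div_of_mul_eq h0 h, hdet, hdet]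
    rfl
  · rw [map_zero] at h
    exact (mul_eq_zero.1 h).resolve_right h0
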